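/- A polygonal domain is a simple closed polygon in $\mathbb{R}^2$ together with its interior. Let $\Delta$ be a (finite) triangulation of a polygonal domain $|\Delta|$: any two triangles are disjoint or meet in a common vertex or a common edge. A boundary edge is an edge contained in only one triangle, an interior vertex is a vertex contained in no boundary edge, and a totally interior edge is an edge connecting two interior vertices. Suppose that $\Delta$ has exactly one totally interior edge $\tau$, with endpoints $v_1,v_2$, and that no other edge containing $v_1$ or $v_2$ has the same slope as $\tau$. Let $s$ (respectively $t$) be the number of different slopes of the edges different from $\tau$ that contain $v_1$ (respectively $v_2$), let $r\ge 0$ be an integer, and assume that $2\le s\le t\le r+1$. Let $\Delta'$ be the partition of $|\Delta|$ obtained from $\Delta$ by deleting the edge $\tau$, that is, by merging the two triangles that contain $\tau$ into one cell. For $P=\Delta$ or $P=\Delta'$ and an integer $d\ge 0$, let $C^r_d(P)$ be the real vector space of functions $F:|\Delta|\to\mathbb{R}$ that are continuously differentiable of order $r$ and whose restriction to each cell of $P$ is a polynomial in $\mathbb{R}[x,y]$ of total degree at most $d$. Then $\Delta'$ is quasi-cross-cut, i.e. every edge of $\Delta'$ is connected to the boundary by a sequence of adjacent edges of $\Delta'$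 that all have the same slope, and for every integer $d\ge 0$ with $$d\le \frac{t}{s(t-1)}\,r+r,$$ the spaces $C^r_d(\Delta)$ and $C^r_d(\Delta')$ are finite-dimensional and $$\dim C^r_d(\Delta)=\dim C^r_d(\Delta').$$ For $s=t=2$ the condition on $d$ reads $d\le 2r$. -/

import Mathlib

noncomputable section

/-- The Euclidean plane. -/
abbrev Plane : Type := EuclideanSpace ℝ (Fin 2)

/-- A polygon is simple if its vertices are pairwise distinct and two different edges meet at most
in a common endpoint (and only if they are consecutive): its boundary is a simple closed curve. -/
def IsSimplePolygon {n : ℕ} (P : Polygon Plane n) : Prop :=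
  3 ≤ n ∧ Function.Injective P.vertices ∧
    ∀ i j : Fin n, i ≠ j → ∀ x ∈ P.edgeSet ℝ i ∩ P.edgeSet ℝ j,
      (j = finRotate n i ∧ x = P j) ∨ (i = finRotate n j ∧ x = P i)

/-- The region enclosed by a polygon: the points off the boundary curve whose connected component
in the complement of that curve is bounded. -/
def polygonInterior {n : ℕ} (P : Polygon Plane n) : Set Plane :=
  {x | x ∉ P.boundary ℝ ∧ Bornology.IsBounded (connectedComponentIn (P.boundary ℝ)ᶜ x)}

/-- A polygonal domain: a simple closed polygon together with its interior. -/
def IsPolygonalDomain (Ω : Set Plane) : Prop :=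
  ∃ (n : ℕ) (P : Polygon Plane n), IsSimplePolygon P ∧ Ω = P.boundary ℝ ∪ polygonInterior P

/-- A triangulation of a polygonal domain: a finite simplicial complex in the plane, all of whose
faces are faces of triangles, and whose underlying space is a polygonal domain. Faces are recorded
by their vertex sets. -/
structure Triangulation extends Geometry.SimplicialComplex ℝ Plane where
  finite_faces : faces.Finite
  pure : ∀ e ∈ faces, ∃ σ ∈ faces, σ.card = 3 ∧ e ⊆ σ
  polygonal : IsPolygonalDomain toSimplicialComplex.space

/-- A subdivision of a planar region, recorded by its closed two-dimensional cells and its edges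
(an edge is given by its set of endpoints). -/
structure PlanarPartition where
  cells : Set (Set Plane)
  edges : Set (Finset Plane)

namespace PlanarPartition

variable (P : PlanarPartition)

/-- The region that is subdivided. -/
def support : Set Plane := ⋃₀ P.cells

/-- `C^r_d(P)`: the real-valued functions on the subdivided region that are continuously
differentiable of order `r` on that (closed) region, and whose restriction to each cell is a
polynomial in two variables of total degree at most `d`. -/
def splineSpace (r d : ℕ) : Submodule ℝ (P.support → ℝ) where
  carrier := {F |
    (∃ G : Plane → ℝ, ContDiffOn ℝ r G P.support ∧ ∀ x : P.support, F x = G x) ∧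
    ∀ c ∈ P.cells, ∃ p : MvPolynomial (Fin 2) ℝ, p.totalDegree ≤ d ∧
      ∀ x : P.support, (x : Plane) ∈ c → F x = MvPolynomial.eval (fun i => (x : Plane) i) p}
  zero_mem' := ⟨⟨fun _ => 0, contDiffOn_const, fun _ => rfl⟩,
    fun _ _ => ⟨0, by simp, fun _ _ => by simp⟩⟩
  add_mem' := by
    rintro F F' ⟨⟨G, hG, hFG⟩, hF⟩ ⟨⟨G', hG', hFG'⟩, hF'⟩
    refine ⟨⟨fun x => G x + G' x, hG.add hG', fun x => by simp [hFG, hFG']⟩, fun c hc => ?_⟩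
    obtain ⟨p, hp, hFp⟩ := hF c hc
    obtain ⟨p', hp', hFp'⟩ := hF' c hc
    exact ⟨p + p', (MvPolynomial.totalDegree_add p p').trans (max_le hp hp'),
      fun x hx => by simp [hFp x hx, hFp' x hx]⟩
  smul_mem' := by
    rintro a F ⟨⟨G, hG, hFG⟩, hF⟩
    refine ⟨⟨fun x => a * G x, contDiffOn_const.mul hG, fun x => by simp [hFG]⟩, fun c hc => ?_⟩
    obtain ⟨p, hp, hFp⟩ := hF c hc
    exact ⟨a • p, (MvPolynomial.totalDegree_smul_le a p).trans hp,
      fun x hx => by simp [hFp x hx, MvPolynomial.smul_eval]⟩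

/-- A boundary edge is an edge that is contained in a single cell. -/
def IsBoundaryEdge (e : Finset Plane) : Prop :=
  e ∈ P.edges ∧ ∃! c : Set Plane, c ∈ P.cells ∧ convexHull ℝ (e : Set Plane) ⊆ c

/-- Two edges are adjacent and of the same slope if they share an endpoint and their affine spans
have the same direction. -/
def AdjacentSameSlope (e f : Finset Plane) : Prop :=
  e ∈ P.edges ∧ f ∈ P.edges ∧ (∃ v, v ∈ e ∧ v ∈ f) ∧
    vectorSpan ℝ (e : Set Plane) = vectorSpan ℝ (f : Set Plane)

/-- Every edge is connected to the boundary by a sequence of adjacent edges that all have the same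
slope. -/
def IsQuasiCrossCut : Prop :=
  ∀ e ∈ P.edges, ∃ f, Relation.ReflTransGen P.AdjacentSameSlope e f ∧
    ∃ v ∈ f, ∃ b, P.IsBoundaryEdge b ∧ v ∈ b

end PlanarPartition

namespace Triangulation

variable (Δ : Triangulation)

/-- The triangles, given by their sets of vertices. -/
def triangles : Set (Finset Plane) := {σ | σ ∈ Δ.faces ∧ σ.card = 3}

/-- The edges, given by their sets of endpoints. -/
def edges : Set (Finset Plane) := {e | e ∈ Δ.faces ∧ e.card = 2}

/-- A boundary edge is an edge that is contained in a single triangle. -/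
def IsBoundaryEdge (e : Finset Plane) : Prop :=
  e ∈ Δ.edges ∧ ∃! σ : Finset Plane, σ ∈ Δ.triangles ∧ e ⊆ σ

/-- An interior vertex is a vertex that is not contained in any boundary edge. -/
def IsInteriorVertex (v : Plane) : Prop :=
  v ∈ Δ.vertices ∧ ∀ e, Δ.IsBoundaryEdge e → v ∉ e

/-- A totally interior edge is an edge that connects two interior vertices. -/
def totallyInteriorEdges : Set (Finset Plane) :=
  {e | e ∈ Δ.edges ∧ ∀ v ∈ e, Δ.IsInteriorVertex v}

/-- The edges different from `τ` that contain the vertex `v`. -/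
def otherEdgesAt (τ : Finset Plane) (v : Plane) : Set (Finset Plane) :=
  {e | e ∈ Δ.edges ∧ v ∈ e ∧ e ≠ τ}

/-- The number of different slopes of the edges different from `τ` that contain `v`; the slope of
an edge is recorded as the direction of its affine span. -/
def numSlopes (τ : Finset Plane) (v : Plane) : ℕ :=
  ((fun e : Finset Plane => vectorSpan ℝ (e : Set Plane)) '' Δ.otherEdgesAt τ v).ncard

/-- The triangulation as a partition of its underlying region into triangles. -/
def toPartition : PlanarPartition where
  cells := (fun σ : Finset Plane => convexHull ℝ (σ : Set Plane)) '' Δ.triangles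
  edges := Δ.edges

/-- The partition obtained by removing the edge `τ`: the triangles that contain `τ` are merged
into one cell, all other triangles and edges are kept. -/
def deleteEdge (τ : Finset Plane) : PlanarPartition where
  cells := insert (⋃ σ ∈ {σ | σ ∈ Δ.triangles ∧ τ ⊆ σ}, convexHull ℝ (σ : Set Plane))
    ((fun σ : Finset Plane => convexHull ℝ (σ : Set Plane)) '' {σ | σ ∈ Δ.triangles ∧ ¬ τ ⊆ σ})
  edges := Δ.edges \ {τ}

end Triangulation

end

open Polynomial

/-! Everything reduces to one claim: if `G` is the difference of the polynomials of a spline on the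
two triangles at `τ`, then `G = 0`. The functions defining splines on the two partitions then
coincide.

Smoothness across `τ` makes `G` divisible by the `(r+1)`-st power of the equation of `τ`. Going
around `v₁` through the other triangles puts `G` in the ideal generated by the `(r+1)`-st powers of
the `s` lines of the other edges; at `v₂` there are `t` such lines (`sub_mem_span`).

Take coordinates `X` along `τ` (0 at `v₁`, 1 at `v₂`) and `Y` transversal to it. If `G ≠ 0`, let
`h(X) Y^J` be its lowest term in `Y`; then `J ≥ r+1`. Let `i` and `i'` be the orders of `h` at 0 and
1, so that `i + i' + J ≤ d`. The homogeneous part of `G` at `v₁` of degree `i + J` is nonzero,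
divisible by `Y^J`, and a combination of `s` powers of linear forms, with coefficients from a space
of dimension `i + J - r`. Such a combination vanishes as soon as its order in `Y` reaches the total
number `s (i + J - r)` of coefficients (`sum_mul_pow_eq_zero`), so `J < s (i + J - r)`. Likewise `J
< t (i' + J - r)`. The bound on `d` excludes this (`degree_bound_contradiction`). -/

/-! ### Binary forms that combine powers of linear forms -/

/-- The differential operator on binary forms of degree `n`, dehomogenized, that kills the `n`-th
power of `p + q X`. -/
noncomputable def Polynomial.polarOp (p q : ℝ) (n : ℕ) (f : ℝ[X]) : ℝ[X] :=
  (C p + C q * X) * derivative f - C (n * q) * f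

namespace Polynomial

theorem coeff_polarOp (p q : ℝ) (n k : ℕ) (f : ℝ[X]) :
    (polarOp p q n f).coeff k = p * ((k + 1) * f.coeff (k + 1)) + q * (k - n) * f.coeff k := by
  unfold polarOp
  cases k with
  | zero => simp [add_mul, mul_assoc, coeff_derivative]; ring
  | succ k =>
    simp only [add_mul, mul_assoc, coeff_sub, coeff_add, coeff_C_mul, coeff_X_mul,
      coeff_derivative]
    push_cast
    ring

theorem polarOp_sum {ι : Type*} (S : Finset ι) (p q : ℝ) (n : ℕ) (f : ι → ℝ[X]) :
    polarOp p q n (∑ i ∈ S, f i) = ∑ i ∈ S, polarOp p q n (f i) := by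
  simp [polarOp, Finset.mul_sum, Finset.sum_sub_distrib]

/-- Homogeneously, the operator is a derivation that kills this linear form, so it passes through
its powers. -/
theorem polarOp_mul_pow_self (p q : ℝ) (e N : ℕ) (c : ℝ[X]) :
    polarOp p q (e + N) (c * (C p + C q * X) ^ N) =
      polarOp p q e c * (C p + C q * X) ^ N := by
  unfold polarOp
  cases N with
  | zero => simp
  | succ N =>
    simp only [derivative_mul, derivative_pow, derivative_add, derivative_C, derivative_X]
    simp only [Nat.cast_add, map_add, map_mul, Nat.cast_one, map_one, map_natCast]
    simp only [Nat.add_sub_cancel]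
    ring

/-- The Leibniz rule for a different linear form costs one factor, and the new cofactor keeps the
degree bound of `c`. In the induction below `N` drops while `E` stays. -/
theorem polarOp_mul_pow (p q p' q' : ℝ) (e N : ℕ) (c : ℝ[X]) :
    polarOp p q (e + (N + 1)) (c * (C p' + C q' * X) ^ (N + 1)) =
      (polarOp p q e c * (C p' + C q' * X) + C ((N + 1) * (q' * p - q * p')) * c) *
        (C p' + C q' * X) ^ N := by
  unfold polarOp
  simp only [derivative_mul, derivative_pow, derivative_add, derivative_C, derivative_X]
  simp only [Nat.cast_add, map_add, map_mul, Nat.cast_one, map_one, map_natCast, map_sub]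
  simp only [Nat.add_sub_cancel]
  ring

/-- The equation is a first-order recursion for the coefficients, solvable upwards because `p ≠ 0`.
-/
theorem eq_zero_of_polarOp_eq_zero {p q : ℝ} (hp : p ≠ 0) {n : ℕ} {f : ℝ[X]}
    (h0 : f.coeff 0 = 0) (h : polarOp p q n f = 0) : f = 0 := by
  ext k
  induction k with
  | zero => simpa using h0
  | succ k ih =>
    have := congrArg (fun g => coeff g k) h
    simp only [coeff_polarOp, ih, coeff_zero, mul_zero, add_zero, mul_eq_zero, hp, false_or] at this
    rcases this with h | h
    · exact absurd h (by positivity)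
    · simpa using h

/-- A combination of powers of linear polynomials, whose coefficients have degrees `< E i`, that
vanishes to order at least `∑ i, E i` at the origin is zero. -/
theorem sum_mul_pow_eq_zero {ι : Type*} (S : Finset ι) (p q : ι → ℝ) (hp : ∀ i ∈ S, p i ≠ 0)
    (M : ℕ) : ∀ (n : ℕ) (E N : ι → ℕ) (c : ι → ℝ[X]), (∀ i ∈ S, E i + N i = n) →
      ∑ i ∈ S, E i = M → (∀ i ∈ S, ∀ k, E i ≤ k → (c i).coeff k = 0) →
      X ^ M ∣ ∑ i ∈ S, c i * (C (p i) + C (q i) * X) ^ N i →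
      ∑ i ∈ S, c i * (C (p i) + C (q i) * X) ^ N i = 0 := by
  classical
  induction M with
  | zero =>
    intro n E N c hEN hE hc _
    refine Finset.sum_eq_zero fun i hi => ?_
    have hEi : E i = 0 := Finset.sum_eq_zero_iff.1 hE i hi
    have : c i = 0 := by
      ext k
      simpa using hc i hi k (by omega)
    simp [this]
  | succ M ih =>
    intro n E N c hEN hE hc hdvd
    set f := ∑ i ∈ S, c i * (C (p i) + C (q i) * X) ^ N i with hf
    -- With an exponent `N j = 0`, the sum has degree below `n = E j ≤ M + 1`, so divisibility alone
    -- kills it. Otherwise the operator of some form `a` with `E a ≠ 0` lowers `E a`, and hence `M`,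
    -- by one.
    by_cases hN : ∃ j ∈ S, N j = 0
    · obtain ⟨j, hj, hNj⟩ := hN
      have hn : n ≤ M + 1 := by
        rw [← hE, ← hEN j hj, hNj]
        exact Finset.single_le_sum (f := E) (fun _ _ => Nat.zero_le _) hj
      by_contra hf0
      have h1 : (M + 1 : ℕ) ≤ f.degree := by
        simpa using degree_le_of_dvd hdvd hf0
      have h2 : f.degree < (M + 1 : ℕ) := by
        rw [hf]
        refine (degree_sum_le _ _).trans_lt ?_
        rw [Finset.sup_lt_iff (WithBot.bot_lt_coe _)]
        intro i hi
        have hci : (c i).degree < E i := (degree_lt_iff_coeff_zero _ _).2 (hc i hi)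
        have hl : (C (p i) + C (q i) * X).degree ≤ 1 := by
          rw [add_comm]; exact degree_linear_le
        calc _ ≤ (c i).degree + N i • (1 : WithBot ℕ) := by
              rw [degree_mul, degree_pow]
              gcongr
          _ < E i + N i • (1 : WithBot ℕ) := by
              rw [nsmul_one]
              exact WithBot.add_lt_add_right (WithBot.natCast_ne_bot _) hci
          _ = (n : ℕ) := by rw [nsmul_one, ← hEN i hi]; norm_cast
          _ ≤ _ := by exact_mod_cast hn
      exact absurd h1 (not_le.2 h2)
    · push Not at hN
      obtain ⟨a, ha, hEa⟩ : ∃ a ∈ S, E a ≠ 0 := by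
        by_contra! h
        rw [Finset.sum_eq_zero h] at hE
        omega
      have hcoeff := X_pow_dvd_iff.1 hdvd
      -- The coefficient bounds are strict, so the sum dehomogenizes a form of degree `n - 1`.
      refine eq_zero_of_polarOp_eq_zero (q := q a) (n := n - 1) (hp a ha)
        (hcoeff 0 (Nat.succ_pos _)) ?_
      have hdvd' : X ^ M ∣ polarOp (p a) (q a) (n - 1) f := by
        refine X_pow_dvd_iff.2 fun k hk => ?_
        simp [coeff_polarOp, hcoeff k (by omega), hcoeff (k + 1) (by omega)]
      -- The operator lowers the degree of the form: at `k = E i - 1` the factor `k - (E i - 1)`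
      -- removes the top coefficient.
      have hlow : ∀ i ∈ S, ∀ k, E i ≤ k + 1 →
          (polarOp (p a) (q a) (E i - 1) (c i)).coeff k = 0 := by
        intro i hi k hk
        rw [coeff_polarOp, hc i hi _ hk]
        rcases hk.lt_or_eq with h | h
        · simp [hc i hi k (by omega)]
        · have : k = E i - 1 := by omega
          simp [this]
      have key : polarOp (p a) (q a) (n - 1) f =
          ∑ i ∈ S, (if i = a then polarOp (p a) (q a) (E i - 1) (c i) else
            polarOp (p a) (q a) (E i - 1) (c i) * (C (p i) + C (q i) * X) +
              C ((N i : ℝ) * (q i * p a - q a * p i)) * c i) *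
            (C (p i) + C (q i) * X) ^ (if i = a then N i else N i - 1) := by
        rw [hf, polarOp_sum]
        refine Finset.sum_congr rfl fun i hi => ?_
        by_cases hEi : E i = 0
        · have : c i = 0 := by
            ext k
            simpa using hc i hi k (by omega)
          simp [this, polarOp]
        have h1 : n - 1 = (E i - 1) + N i := by have := hEN i hi; omega
        by_cases hia : i = a
        · subst hia
          simp only [if_true]
          rw [h1, polarOp_mul_pow_self]
        · simp only [hia, if_false]
          obtain ⟨m, hm⟩ := Nat.exists_eq_succ_of_ne_zero (hN i hi)
          rw [h1, hm, Nat.succ_eq_add_one, polarOp_mul_pow]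
          simp
      rw [key] at hdvd' ⊢
      refine ih (n - 1) (fun i => if i = a then E i - 1 else E i) _ _ ?_ ?_ ?_ hdvd'
      · intro i hi
        have := hEN i hi
        have := hN i hi
        split_ifs with h
        · subst h; omega
        · omega
      · have hsum : ∑ i ∈ S.erase a, (if i = a then E i - 1 else E i) = ∑ i ∈ S.erase a, E i :=
          Finset.sum_congr rfl fun i hi => if_neg (Finset.ne_of_mem_erase hi)
        rw [← Finset.add_sum_erase _ _ ha] at hE ⊢
        rw [if_pos rfl, hsum]
        omega
      · intro i hi k hk
        split_ifs at hk ⊢ with h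
        · exact hlow i hi k (by omega)
        · have hlin : ∀ g : ℝ[X], (∀ k, E i ≤ k + 1 → g.coeff k = 0) →
              ∀ k, E i ≤ k → (g * (C (p i) + C (q i) * X)).coeff k = 0 := by
            intro g hg k hk
            rw [mul_add, coeff_add, coeff_mul_C, hg k (by omega), mul_left_comm, coeff_C_mul]
            cases k with
            | zero => simp
            | succ k => simp [hg k hk]
          rw [coeff_add, hlin _ (hlow i hi) k hk, coeff_C_mul, hc i hi k hk]
          simp

/-! ### Smooth gluing in one variable -/

theorem iteratedDeriv_eval_zero (p : ℝ[X]) (j : ℕ) :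
    iteratedDeriv j (fun x => p.eval x) 0 = j.factorial * p.coeff j := by
  have h : ∀ (j : ℕ) (p : ℝ[X]),
      iteratedDeriv j (fun x => p.eval x) = fun x => (derivative^[j] p).eval x := by
    intro j
    induction j with
    | zero => intro p; simp
    | succ j ih =>
      intro p
      have : deriv (fun x => p.eval x) = fun x => (derivative p).eval x := by
        ext x; simp
      rw [iteratedDeriv_succ', this, ih, Function.iterate_succ_apply]
  rw [h]
  simp only [← coeff_zero_eq_eval_zero, coeff_iterate_derivative, zero_add,
    Nat.descFactorial_self, nsmul_eq_mul]

/-- If a function of class `C^r` is given by polynomials on either side of the origin, these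
polynomials agree up to order `r`. -/
theorem coeff_eq_of_contDiffOn {f : ℝ → ℝ} {p q : ℝ[X]} {r : ℕ} {ε : ℝ} (hε : 0 < ε)
    (hf : ContDiffOn ℝ r f (Set.Icc (-ε) ε)) (hp : ∀ x ∈ Set.Icc 0 ε, f x = p.eval x)
    (hq : ∀ x ∈ Set.Icc (-ε) 0, f x = q.eval x) {j : ℕ} (hj : j ≤ r) :
    p.coeff j = q.coeff j := by
  have hfa : ContDiffAt ℝ j f 0 := (hf.contDiffAt (Icc_mem_nhds (by linarith) hε)).of_le
    (by exact_mod_cast hj)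
  -- Derivatives within an interval ending at 0 agree with the two-sided ones, so either piece
  -- computes the derivatives of `f`.
  have key : ∀ (g : ℝ[X]) (a b : ℝ), a < b → 0 ∈ Set.Icc a b →
      (∀ x ∈ Set.Icc a b, f x = g.eval x) →
      j.factorial * g.coeff j = iteratedDeriv j f 0 := by
    intro g a b hab h0 hg
    have hu : UniqueDiffOn ℝ (Set.Icc a b) := uniqueDiffOn_Icc hab
    have hga : ContDiffAt ℝ j (fun x => g.eval x) 0 := by
      simpa using (g.contDiff_aeval (𝕜 := ℝ) (n := j)).contDiffAt
    rw [← iteratedDeriv_eval_zero, ← iteratedDerivWithin_eq_iteratedDeriv hu hga h0,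
      ← iteratedDerivWithin_eq_iteratedDeriv hu hfa h0]
    exact (iteratedDerivWithin_congr hg h0).symm
  have h1 := key p 0 ε hε ⟨le_rfl, hε.le⟩ hp
  have h2 := key q (-ε) 0 (by linarith) ⟨by linarith, le_rfl⟩ hq
  have h3 : (j.factorial : ℝ) ≠ 0 := by positivity
  exact mul_left_cancel₀ h3 (h1.trans h2.symm)

end Polynomial

/-! ### Affine and blow-up coordinates -/

/-- The determinant of two plane vectors. -/
def planeDet (a b : Plane) : ℝ := a 0 * b 1 - a 1 * b 0

/-- An equation of the line through `v` with direction `w`. -/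
noncomputable def lineForm (v w : Plane) : MvPolynomial (Fin 2) ℝ :=
  MvPolynomial.C (w 1) * (MvPolynomial.X 0 - MvPolynomial.C (v 0)) -
    MvPolynomial.C (w 0) * (MvPolynomial.X 1 - MvPolynomial.C (v 1))

/-- Substitution of the affine coordinates with origin `v` and axes `a`, `b`. -/
noncomputable def coordHom (v a b : Plane) : MvPolynomial (Fin 2) ℝ →ₐ[ℝ] ℝ[X][X] :=
  MvPolynomial.aeval fun i => C (C (v i) + C (a i) * X) + C (C (b i)) * X

/-- Substitution of the blow-up coordinates at `v`, in which a point is `v + T (a + u b)`; the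
outer variable is `T`. -/
noncomputable def blowupHom (v a b : Plane) : MvPolynomial (Fin 2) ℝ →ₐ[ℝ] ℝ[X][X] :=
  MvPolynomial.aeval fun i => C (C (v i)) + C (C (a i) + C (b i) * X) * X

theorem coordHom_C (v a b : Plane) (z : ℝ) : coordHom v a b (MvPolynomial.C z) = C (C z) := by
  simp [coordHom, MvPolynomial.algHom_C, Polynomial.algebraMap_apply]

theorem coordHom_X (v a b : Plane) (i : Fin 2) :
    coordHom v a b (MvPolynomial.X i) = C (C (v i) + C (a i) * X) + C (C (b i)) * X := by
  simp [coordHom]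

theorem blowupHom_C (v a b : Plane) (z : ℝ) : blowupHom v a b (MvPolynomial.C z) = C (C z) := by
  simp [blowupHom, MvPolynomial.algHom_C, Polynomial.algebraMap_apply]

theorem blowupHom_X (v a b : Plane) (i : Fin 2) :
    blowupHom v a b (MvPolynomial.X i) = C (C (v i)) + C (C (a i) + C (b i) * X) * X := by
  simp [blowupHom]

theorem blowupHom_lineForm (v a b w : Plane) :
    blowupHom v a b (lineForm v w) = C (C (planeDet a w) + C (planeDet b w) * X) * X := by
  simp only [lineForm, planeDet, map_sub, map_mul, map_add, blowupHom_C, blowupHom_X]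
  ring

theorem coordHom_lineForm (v a b : Plane) :
    coordHom v a b (lineForm v a) = C (C (-planeDet a b)) * X := by
  simp only [lineForm, planeDet, map_sub, map_mul, map_add, map_neg, coordHom_C, coordHom_X]
  ring

theorem coeff_blowupHom_of_lt (v a b : Plane) (p : MvPolynomial (Fin 2) ℝ) :
    ∀ {n j : ℕ}, n < j → ((blowupHom v a b p).coeff n).coeff j = 0 := by
  induction p using MvPolynomial.induction_on with
  | C z =>
    intro n j h
    rw [blowupHom_C, coeff_C]
    split_ifs with h0
    · rw [coeff_C, if_neg (by omega)]
    · simp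
  | add p q hp hq =>
    intro n j h
    simp [hp h, hq h]
  | mul_X p i hp =>
    intro n j h
    rw [map_mul, blowupHom_X, mul_add, coeff_add, coeff_mul_C, coeff_add, coeff_mul_C, hp h,
      ← mul_assoc]
    cases n with
    | zero => simp
    | succ n =>
      obtain ⟨j, rfl⟩ : ∃ m, j = m + 1 := ⟨j - 1, by omega⟩
      rw [coeff_mul_X, coeff_mul_C, mul_add, coeff_add, coeff_mul_C, ← mul_assoc, coeff_mul_X,
        coeff_mul_C, hp (by omega), hp (by omega)]
      simp

/-- The blow-up sends `X^k Y^j` to `T^(k+j) u^j`. Thus its `T^m`-coefficient is the homogeneous part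
of degree `m` at `v`, dehomogenized in `u`. -/
theorem coeff_blowupHom (v a b : Plane) (p : MvPolynomial (Fin 2) ℝ) :
    ∀ k j : ℕ, ((blowupHom v a b p).coeff (k + j)).coeff j =
      ((coordHom v a b p).coeff j).coeff k := by
  induction p using MvPolynomial.induction_on with
  | C z =>
    intro k j
    rw [blowupHom_C, coordHom_C]
    cases j <;> cases k <;> simp [coeff_C]
  | add p q hp hq =>
    intro k j
    simp [hp, hq]
  | mul_X p i hp =>
    intro k j
    rw [map_mul, map_mul, blowupHom_X, coordHom_X, mul_add, mul_add, coeff_add, coeff_add,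
      coeff_add, coeff_add, coeff_mul_C, coeff_mul_C, coeff_mul_C, mul_add, coeff_add,
      coeff_mul_C, ← mul_assoc, ← mul_assoc, ← mul_assoc, hp k j, add_assoc]
    congr 1
    cases k with
    | zero =>
      cases j with
      | zero => simp
      | succ j =>
        rw [zero_add, coeff_mul_X, coeff_mul_C, mul_add, coeff_add, coeff_mul_C, ← mul_assoc,
          coeff_mul_X, coeff_mul_C, coeff_blowupHom_of_lt _ _ _ _ (Nat.lt_succ_self j),
          coeff_mul_X_zero, coeff_mul_X, coeff_mul_C, coeff_mul_C, ← hp 0 j, zero_add]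
        simp
    | succ k =>
      rw [show k + 1 + j = (k + j) + 1 by omega, coeff_mul_X, coeff_mul_C, mul_add, coeff_add,
        coeff_mul_C, hp k j, coeff_mul_X, coeff_mul_C]
      congr 1
      cases j with
      | zero => simp
      | succ j =>
        rw [← mul_assoc, coeff_mul_X, coeff_mul_C, coeff_mul_X, coeff_mul_C, coeff_mul_C,
          show k + (j + 1) = (k + 1) + j by omega, hp]

theorem coeff_coordHom_of_lt (v a b : Plane) {p : MvPolynomial (Fin 2) ℝ} {d : ℕ}
    (hp : p.totalDegree ≤ d) {j k : ℕ} (h : d < j + k) :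
    ((coordHom v a b p).coeff j).coeff k = 0 := by
  have hmul : ∀ (W : ℝ[X][X]) (i : Fin 2) (e : ℕ),
      (∀ j k, e < j + k → (W.coeff j).coeff k = 0) → ∀ j k, e + 1 < j + k →
      ((W * (C (C (v i) + C (a i) * X) + C (C (b i)) * X)).coeff j).coeff k = 0 := by
    intro W i e hW j k h
    rw [mul_add, coeff_add, coeff_mul_C, coeff_add, ← mul_assoc, mul_add, coeff_add, coeff_mul_C,
      hW j k (by omega), ← mul_assoc]
    have h1 : (W.coeff j * C (a i) * X).coeff k = 0 := by
      cases k with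
      | zero => simp
      | succ k => rw [coeff_mul_X, coeff_mul_C, hW j k (by omega), zero_mul]
    have h2 : ((W * C (C (b i)) * X).coeff j).coeff k = 0 := by
      cases j with
      | zero => simp
      | succ j => rw [coeff_mul_X, coeff_mul_C, coeff_mul_C, hW j k (by omega), zero_mul]
    rw [h1, h2]
    simp
  have hpow : ∀ (m : ℕ) (W : ℝ[X][X]) (i : Fin 2) (e : ℕ),
      (∀ j k, e < j + k → (W.coeff j).coeff k = 0) → ∀ j k, e + m < j + k →
      ((W * (C (C (v i) + C (a i) * X) + C (C (b i)) * X) ^ m).coeff j).coeff k = 0 := by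
    intro m
    induction m with
    | zero => intro W i e hW j k h; simpa using hW j k h
    | succ m ih =>
      intro W i e hW j k h
      rw [pow_succ, ← mul_assoc]
      exact hmul _ i (e + m) (ih W i e hW) j k h
  rw [p.as_sum, map_sum, finsetSum_coeff, finsetSum_coeff]
  refine Finset.sum_eq_zero fun m hm => ?_
  have hdeg : m 0 + m 1 ≤ d := by
    have := (MvPolynomial.le_totalDegree hm).trans hp
    rwa [Finsupp.sum_fintype _ _ (fun _ => rfl), Fin.sum_univ_two] at this
  rw [coordHom, MvPolynomial.aeval_monomial, Finsupp.prod_fintype _ _ (fun _ => pow_zero _),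
    Fin.prod_univ_two, ← mul_assoc]
  refine hpow _ _ _ (m 0) ?_ j k (by omega)
  intro j k h
  refine hpow _ _ _ 0 ?_ j k (by omega)
  intro j k h
  rw [Polynomial.algebraMap_apply, algebraMap_eq, coeff_C]
  split_ifs with hj
  · rw [coeff_C, if_neg (by omega)]
  · simp

/-- The inverse of `coordHom`. -/
noncomputable def coordInv (v a b : Plane) : ℝ[X][X] →+* MvPolynomial (Fin 2) ℝ :=
  eval₂RingHom (aeval (MvPolynomial.C (planeDet a b)⁻¹ * lineForm v b)).toRingHom
    (MvPolynomial.C (-(planeDet a b)⁻¹) * lineForm v a)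

theorem coordInv_coordHom {v a b : Plane} (h : planeDet a b ≠ 0) (p : MvPolynomial (Fin 2) ℝ) :
    coordInv v a b (coordHom v a b p) = p := by
  have hC : MvPolynomial.C (planeDet a b)⁻¹ * (MvPolynomial.C (a 0) * MvPolynomial.C (b 1) -
      MvPolynomial.C (a 1) * MvPolynomial.C (b 0)) = (1 : MvPolynomial (Fin 2) ℝ) := by
    rw [← map_mul, ← map_mul, ← map_sub, ← map_mul, ← planeDet, inv_mul_cancel₀ h, map_one]
  have : (coordInv v a b).comp (coordHom v a b).toRingHom = RingHom.id _ := by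
    refine MvPolynomial.ringHom_ext (fun z => ?_) fun i => ?_
    · simp [coordInv]
    · simp only [RingHom.comp_apply, AlgHom.toRingHom_eq_coe, RingHom.coe_coe, coordHom_X,
        coordInv, coe_eval₂RingHom, eval₂_C, eval₂_X, map_add, map_mul,
        aeval_C, aeval_X, RingHom.id_apply, MvPolynomial.algebraMap_eq]
      fin_cases i
      · simp only [lineForm, map_neg, Fin.zero_eta]
        linear_combination (MvPolynomial.X 0 - MvPolynomial.C (v 0)) * hC
      · simp only [lineForm, map_neg, Fin.mk_one]
        linear_combination (MvPolynomial.X 1 - MvPolynomial.C (v 1)) * hC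
  exact DFunLike.congr_fun this p

theorem coordHom_injective {v a b : Plane} (h : planeDet a b ≠ 0) :
    Function.Injective (coordHom v a b) :=
  Function.LeftInverse.injective (coordInv_coordHom h)

/-- The inverse substitution takes the transversal coordinate to a multiple of the line form. -/
theorem lineForm_pow_dvd {v a b : Plane} (h : planeDet a b ≠ 0) {p : MvPolynomial (Fin 2) ℝ}
    {m : ℕ} (hp : X ^ m ∣ coordHom v a b p) : lineForm v a ^ m ∣ p := by
  obtain ⟨g, hg⟩ := hp
  rw [← coordInv_coordHom h p, hg, map_mul, map_pow]
  refine Dvd.dvd.mul_right (pow_dvd_pow_of_dvd ?_ m) _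
  simp [coordInv]

theorem coeff_coordHom_of_lineForm_pow_dvd {v a b : Plane} {p : MvPolynomial (Fin 2) ℝ}
    {m : ℕ} (hp : lineForm v a ^ m ∣ p) {j : ℕ} (hj : j < m) : (coordHom v a b p).coeff j = 0 := by
  obtain ⟨g, rfl⟩ := hp
  refine X_pow_dvd_iff.1 ?_ j hj
  rw [map_mul, map_pow, coordHom_lineForm, mul_pow]
  exact Dvd.dvd.mul_right (Dvd.intro_left _ rfl) _

/-- Keeping `b` fixed while reversing the edge preserves the powers of `Y`, so the lowest `Y`-term
can be studied at both endpoints. -/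
theorem coordHom_reverse (v a b : Plane) (p : MvPolynomial (Fin 2) ℝ) (j : ℕ) :
    (coordHom (v + a) (-a) b p).coeff j = ((coordHom v a b p).coeff j).comp (1 - X) := by
  have : (coordHom (v + a) (-a) b).toRingHom =
      (mapRingHom (compRingHom (1 - X))).comp (coordHom v a b).toRingHom := by
    refine MvPolynomial.ringHom_ext (fun z => ?_) fun i => ?_
    · simp
    · simp only [RingHom.comp_apply, AlgHom.toRingHom_eq_coe, RingHom.coe_coe, coordHom_X]
      simp
      ring
  have := DFunLike.congr_fun this p
  simp only [RingHom.comp_apply, AlgHom.toRingHom_eq_coe, RingHom.coe_coe] at this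
  rw [this]
  simp

/-! ### Vanishing of the difference across the edge -/

theorem lt_card_mul_of_mem_span {ι : Type*} {S : Finset ι} {w : ι → Plane} {v a b : Plane}
    (hw : ∀ i ∈ S, planeDet a (w i) ≠ 0) {r : ℕ} {G : MvPolynomial (Fin 2) ℝ}
    (hG : G ∈ Ideal.span ((fun i => lineForm v (w i) ^ (r + 1)) '' (S : Set ι))) {J k : ℕ}
    (hr : r + 1 ≤ J) (hJ : ((coordHom v a b G).coeff J).coeff k ≠ 0)
    (hlt : ∀ j < J, (coordHom v a b G).coeff j = 0) :
    J < S.card * (k + J - r) := by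
  by_contra! hle
  obtain ⟨c, hc⟩ := (Submodule.mem_span_image_finset_iff_exists_fun' _).1 hG
  set n := k + J - (r + 1) with hn
  have hcoeff : (blowupHom v a b G).coeff (k + J) = ∑ i ∈ S, (blowupHom v a b (c i)).coeff n *
      (C (planeDet a (w i)) + C (planeDet b (w i)) * X) ^ (r + 1) := by
    rw [← hc, map_sum, finsetSum_coeff]
    refine Finset.sum_congr rfl fun i _ => ?_
    rw [smul_eq_mul, map_mul, map_pow, blowupHom_lineForm, mul_pow, ← C_pow, ← mul_assoc,
      show k + J = n + (r + 1) by omega, coeff_mul_X_pow, coeff_mul_C]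
  -- Cofactors of degree at most `n` give `E = n + 1 = k + J - r`. All terms of `G` have `Y`-order
  -- at least `J`, which in the negated case reaches the sum of the `E`.
  have hzero : (blowupHom v a b G).coeff (k + J) = 0 := by
    rw [hcoeff]
    refine sum_mul_pow_eq_zero S _ _ hw (S.card * (k + J - r)) (n + 1 + (r + 1))
      (fun _ => n + 1) (fun _ => r + 1) _ (fun _ _ => rfl) ?_ ?_ ?_
    · rw [Finset.sum_const, smul_eq_mul]
      congr 1
      omega
    · intro i _ m hm
      exact coeff_blowupHom_of_lt _ _ _ _ hm
    · rw [← hcoeff]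
      refine X_pow_dvd_iff.2 fun j hj => ?_
      rw [show k + J = (k + J - j) + j by omega, coeff_blowupHom, hlt j (by omega), coeff_zero]
  exact hJ (by rw [← coeff_blowupHom, hzero, coeff_zero])

/-- With `K = J - r`, the lower bounds for `i` and `i'` give `i + i' + K ≥ (r+1+K)(1/s + 1/t) - K`,
which does not increase with `K` since `t ≤ s (t - 1)`. Once `(t-1) K ≥ r+1` the bound `i' ≥ 0` is
the better one. At the crossover both give `(r+1) t / (s (t-1))`, more than `d - r`. -/
theorem degree_bound_contradiction {r d s t J i i' : ℕ} (hs2 : 2 ≤ s) (hst : s ≤ t)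
    (hd : (d : ℝ) ≤ (t : ℝ) / ((s : ℝ) * ((t : ℝ) - 1)) * (r : ℝ) + (r : ℝ)) (hr : r + 1 ≤ J)
    (hi : J < s * (i + J - r)) (hi' : J < t * (i' + J - r)) (hdeg : i + i' + J ≤ d) : False := by
  obtain ⟨K, rfl⟩ : ∃ K, J = r + K := ⟨J - r, by omega⟩
  rw [show i + (r + K) - r = i + K by omega] at hi
  rw [show i' + (r + K) - r = i' + K by omega] at hi'
  have hs : (2 : ℝ) ≤ s := by exact_mod_cast hs2
  have ht : (s : ℝ) ≤ t := by exact_mod_cast hst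
  have h1 : (r : ℝ) + K + 1 ≤ s * (i + K) := by exact_mod_cast hi
  have h2 : (r : ℝ) + K + 1 ≤ t * (i' + K) := by exact_mod_cast hi'
  have h3 : (i : ℝ) + i' + K ≤ d - r := by
    have : (i : ℝ) + i' + (r + K) ≤ d := by exact_mod_cast hdeg
    linarith
  have hi0 : (0 : ℝ) ≤ i' := by positivity
  have hr0 : (0 : ℝ) ≤ r := by positivity
  have hpos : (0 : ℝ) < s * (t - 1) := by apply mul_pos <;> linarith
  have h4 : ((d : ℝ) - r) * (s * (t - 1)) ≤ t * r := by
    have : (d : ℝ) - r ≤ t * r / (s * (t - 1)) := by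
      rw [mul_div_right_comm]; linarith
    rwa [le_div_iff₀ hpos] at this
  have h5 : ((i : ℝ) + i' + K) * (s * (t - 1)) ≤ t * r :=
    (mul_le_mul_of_nonneg_right h3 hpos.le).trans h4
  have ht1 : (0 : ℝ) ≤ t - 1 := by linarith
  rcases le_total ((r : ℝ) + 1) ((t - 1) * K) with h | h
  · have h6 := mul_le_mul_of_nonneg_right h1 ht1
    have h7 : 0 ≤ (i' : ℝ) * (s * (t - 1)) := by positivity
    nlinarith
  · have h6 := mul_le_mul_of_nonneg_left h1 (mul_nonneg ht1 (by linarith : (0 : ℝ) ≤ t))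
    have h7 := mul_le_mul_of_nonneg_left h2 (mul_nonneg ht1 (by linarith : (0 : ℝ) ≤ s))
    have h8 := mul_le_mul_of_nonneg_left h5 (by linarith : (0 : ℝ) ≤ t)
    have h9 : (t : ℝ) ≤ s * (t - 1) := by nlinarith
    have h10 := mul_nonneg (sub_nonneg.2 h9) (sub_nonneg.2 h)
    nlinarith

/-- A polynomial of low degree that lies in the three ideals attached to an edge `v, v + a` and
its two endpoints is zero. -/
theorem eq_zero_of_mem_span {ι ι' : Type*} {S : Finset ι} {S' : Finset ι'} {w : ι → Plane}
    {w' : ι' → Plane} {v a b : Plane} (hab : planeDet a b ≠ 0)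
    (hw : ∀ i ∈ S, planeDet a (w i) ≠ 0) (hw' : ∀ i ∈ S', planeDet a (w' i) ≠ 0) {r d : ℕ}
    {G : MvPolynomial (Fin 2) ℝ} (hGd : G.totalDegree ≤ d)
    (hG : G ∈ Ideal.span ((fun i => lineForm v (w i) ^ (r + 1)) '' (S : Set ι)))
    (hG' : G ∈ Ideal.span ((fun i => lineForm (v + a) (w' i) ^ (r + 1)) '' (S' : Set ι')))
    (hGa : lineForm v a ^ (r + 1) ∣ G) (hs2 : 2 ≤ S.card) (hst : S.card ≤ S'.card)
    (hd : (d : ℝ) ≤ (S'.card : ℝ) / ((S.card : ℝ) * ((S'.card : ℝ) - 1)) * (r : ℝ) + (r : ℝ)) :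
    G = 0 := by
  classical
  by_contra hG0
  have hex : ∃ j, (coordHom v a b G).coeff j ≠ 0 := by
    by_contra! h
    exact hG0 (coordHom_injective (v := v) hab (by rw [map_zero]; ext1 j; simpa using h j))
  set J := Nat.find hex with hJdef
  have hJ : (coordHom v a b G).coeff J ≠ 0 := Nat.find_spec hex
  have hlt : ∀ j < J, (coordHom v a b G).coeff j = 0 := fun j hj => by
    simpa using Nat.find_min hex hj
  have hr : r + 1 ≤ J := by
    by_contra! h
    exact hJ (coeff_coordHom_of_lineForm_pow_dvd hGa h)
  set h := (coordHom v a b G).coeff J with hh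
  have hcomp : h.comp (1 - X) ≠ 0 := by
    intro h0
    apply hJ
    have := congrArg (fun g => g.comp (1 - X)) h0
    simpa [comp_assoc] using this
  set i := h.natTrailingDegree with hi
  set i' := (h.comp (1 - X)).natTrailingDegree with hi'
  have hX : X ^ i ∣ h := X_pow_dvd_iff.2 fun m hm => coeff_eq_zero_of_lt_natTrailingDegree hm
  have hX' : (1 - X) ^ i' ∣ h := by
    obtain ⟨g, hg⟩ : X ^ i' ∣ h.comp (1 - X) :=
      X_pow_dvd_iff.2 fun m hm => coeff_eq_zero_of_lt_natTrailingDegree hm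
    have := congrArg (fun g => g.comp (1 - X)) hg
    simp only [comp_assoc, mul_comp, pow_comp, X_comp, sub_comp, one_comp, sub_sub_cancel,
      comp_X] at this
    exact ⟨_, this⟩
  -- The zeros of `h` at the two endpoints are independent, so their orders add up in its degree.
  have hco : IsCoprime (X ^ i : ℝ[X]) ((1 - X) ^ i') := IsCoprime.pow ⟨1, 1, by ring⟩
  have hdeg : i + i' ≤ h.natDegree := by
    have h1 : (1 - X : ℝ[X]).natDegree = 1 := by
      rw [← neg_sub, natDegree_neg]; simpa using natDegree_X_sub_C (1 : ℝ)
    have h2 : (1 - X : ℝ[X]) ≠ 0 := by intro h0; simp [h0] at h1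
    have := natDegree_le_of_dvd (hco.mul_dvd hX hX') hJ
    rwa [natDegree_mul (pow_ne_zero _ X_ne_zero) (pow_ne_zero _ h2), natDegree_pow, natDegree_pow,
      natDegree_X, h1, mul_one, mul_one] at this
  have hdJ : h.natDegree + J ≤ d := by
    by_contra! hc
    have := coeff_coordHom_of_lt v a b hGd (j := J) (k := h.natDegree) (by omega)
    exact hJ (leadingCoeff_eq_zero.1 this)
  have b1 := lt_card_mul_of_mem_span hw hG hr (k := i)
    (mt coeff_natTrailingDegree_eq_zero.1 hJ) hlt
  have b2 : J < S'.card * (i' + J - r) := by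
    refine lt_card_mul_of_mem_span (a := -a) (b := b) ?_ hG' hr ?_ ?_
    · intro m hm
      have := hw' m hm
      intro h0
      apply this
      simp only [planeDet, PiLp.neg_apply] at h0 ⊢
      linarith
    · rw [coordHom_reverse]
      exact mt coeff_natTrailingDegree_eq_zero.1 hcomp
    · intro j hj
      rw [coordHom_reverse, hlt j hj, zero_comp]
  exact degree_bound_contradiction hs2 hst hd hr b1 b2 (by omega)

/-! ### Plane geometry and smoothness across an edge -/

theorem Plane.ext {x y : Plane} (h0 : x 0 = y 0) (h1 : x 1 = y 1) : x = y := by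
  ext i
  fin_cases i <;> assumption

theorem planeDet_add_right (a b c : Plane) : planeDet a (b + c) = planeDet a b + planeDet a c := by
  simp [planeDet]; ring

theorem planeDet_smul_right (t : ℝ) (a b : Plane) : planeDet a (t • b) = t * planeDet a b := by
  simp [planeDet]; ring

theorem planeDet_self (a : Plane) : planeDet a a = 0 := by
  simp [planeDet]; ring

theorem eq_smul_add_smul_of_planeDet_ne_zero {e w : Plane} (h : planeDet e w ≠ 0) (x : Plane) :
    x = (planeDet x w / planeDet e w) • e + (planeDet e x / planeDet e w) • w := by
  apply Plane.ext <;>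
  · simp only [PiLp.add_apply, PiLp.smul_apply, smul_eq_mul]
    field_simp
    simp only [planeDet]
    ring

theorem exists_eq_smul_of_planeDet_eq_zero {a b : Plane} (h : planeDet a b = 0) (ha : a ≠ 0) :
    ∃ t : ℝ, b = t • a := by
  unfold planeDet at h
  by_cases h0 : a 0 = 0
  · have h1 : a 1 ≠ 0 := fun h1 => ha (Plane.ext (by simpa using h0) (by simpa using h1))
    refine ⟨b 1 / a 1, Plane.ext ?_ ?_⟩
    · have : b 0 = 0 := by simpa [h0, h1] using h
      simp [this, h0]
    · simp [h1]
  · refine ⟨b 0 / a 0, Plane.ext ?_ ?_⟩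
    · simp [h0]
    · simp only [PiLp.smul_apply, smul_eq_mul]
      field_simp
      linarith

theorem mem_convexHull_triple {a b q : Plane} {s t : ℝ} (hs : 0 ≤ s) (ht : 0 ≤ t)
    (hst : s + t ≤ 1) : a + s • (b - a) + t • (q - a) ∈ convexHull ℝ {a, b, q} := by
  have h := (convex_convexHull ℝ ({a, b, q} : Set Plane)).sum_mem (t := Finset.univ)
    (w := ![1 - s - t, s, t]) (z := ![a, b, q]) ?_ ?_ ?_
  · convert h using 1
    simp only [Fin.sum_univ_three, Matrix.cons_val]
    module
  · intro i _
    fin_cases i <;> simp <;> linarith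
  · simp only [Fin.sum_univ_three, Matrix.cons_val]
    ring
  · intro i _
    apply subset_convexHull
    fin_cases i <;> simp

/-- A short segment that starts in the interior of the side `a, b` of a triangle and points to the
side of the third vertex `q` stays in the triangle. -/
theorem exists_segment_subset_convexHull {a b q w : Plane} {α γ u : ℝ} (hγ : 0 < γ)
    (hq : q - a = α • (b - a) + γ • w) (hu0 : 0 < u) (hu1 : u < 1) :
    ∃ ε > (0 : ℝ), ∀ s ∈ Set.Icc 0 ε, a + u • (b - a) + s • w ∈ convexHull ℝ {a, b, q} := by
  have hα : 0 < |α| + 1 := by positivity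
  have hm : 0 < min u (1 - u) := lt_min hu0 (by linarith)
  -- In the basis `b - a`, `q - a` the coordinates are `u - sα/γ` and `s/γ`. The summand 1 next to
  -- `|α|` accounts for `s/γ` in their sum.
  refine ⟨γ * min u (1 - u) / (|α| + 1), by positivity, fun s hs => ?_⟩
  have h1 : s / γ * (|α| + 1) ≤ min u (1 - u) := by
    have := hs.2
    rw [le_div_iff₀ hα] at this
    rw [div_mul_eq_mul_div, div_le_iff₀ hγ]
    linarith
  have h2 : 0 ≤ s / γ := div_nonneg hs.1 hγ.le
  have h3 : s / γ * α ≤ s / γ * |α| := mul_le_mul_of_nonneg_left (le_abs_self α) h2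
  have h4 : s / γ * -α ≤ s / γ * |α| := mul_le_mul_of_nonneg_left (neg_le_abs α) h2
  have h5 := h1.trans (min_le_left _ _)
  have h6 := h1.trans (min_le_right _ _)
  have h : a + u • (b - a) + s • w =
      a + (u - s / γ * α) • (b - a) + (s / γ) • (q - a) := by
    rw [hq, smul_add, smul_smul, smul_smul, div_mul_cancel₀ _ hγ.ne']
    module
  rw [h]
  apply mem_convexHull_triple
  · linarith
  · exact h2
  · linarith

theorem eval_coordHom (v a b : Plane) (P : MvPolynomial (Fin 2) ℝ) (u s : ℝ) :
    ((coordHom v a b P).map (evalRingHom u)).eval s =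
      MvPolynomial.eval (fun i => (v + u • a + s • b) i) P := by
  have : ((evalRingHom s).comp (mapRingHom (evalRingHom u))).comp (coordHom v a b).toRingHom =
      MvPolynomial.eval (fun i => (v + u • a + s • b) i) := by
    refine MvPolynomial.ringHom_ext (fun z => ?_) fun i => ?_
    · simp
    · simp only [RingHom.comp_apply, AlgHom.toRingHom_eq_coe, RingHom.coe_coe, coordHom_X]
      simp
      ring
  exact DFunLike.congr_fun this P

/-- If a function of class `C^r` is polynomial on two triangles on the two sides of a common edge,
the polynomials agree up to order `r` along that edge. -/
theorem lineForm_pow_dvd_sub {K : Set Plane} {f : Plane → ℝ} {r : ℕ} (hf : ContDiffOn ℝ r f K)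
    {a b p q : Plane} (hp : convexHull ℝ {a, b, p} ⊆ K) (hq : convexHull ℝ {a, b, q} ⊆ K)
    {P Q : MvPolynomial (Fin 2) ℝ}
    (hP : ∀ x ∈ convexHull ℝ {a, b, p}, f x = MvPolynomial.eval (fun i => x i) P)
    (hQ : ∀ x ∈ convexHull ℝ {a, b, q}, f x = MvPolynomial.eval (fun i => x i) Q)
    (hpq : planeDet (b - a) (p - a) * planeDet (b - a) (q - a) < 0) :
    lineForm a (b - a) ^ (r + 1) ∣ P - Q := by
  have hD : planeDet (b - a) (p - a) ≠ 0 := fun h => by simp [h] at hpq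
  refine lineForm_pow_dvd hD (X_pow_dvd_iff.2 fun j hj => ?_)
  -- The `Y^j`-coefficient is a polynomial along the edge. It suffices to compare one-variable
  -- expansions on a transversal segment through each interior point `u`.
  refine eq_zero_of_infinite_isRoot _ ((Set.Ioo_infinite (zero_lt_one' ℝ)).mono fun u hu => ?_)
  obtain ⟨ε₁, h1, h1'⟩ := exists_segment_subset_convexHull (a := a) (b := b) (q := p) (w := p - a)
    (α := 0) (γ := 1) one_pos (by simp) hu.1 hu.2
  obtain ⟨ε₂, h2, h2'⟩ := exists_segment_subset_convexHull (a := a) (b := b) (q := q)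
    (w := -(p - a)) (γ := -(planeDet (b - a) (q - a) / planeDet (b - a) (p - a)))
    (α := planeDet (q - a) (p - a) / planeDet (b - a) (p - a))
    (by
      rw [neg_pos, div_eq_mul_inv]
      have : planeDet (b - a) (q - a) * (planeDet (b - a) (p - a))⁻¹ =
        (planeDet (b - a) (p - a) * planeDet (b - a) (q - a)) *
          ((planeDet (b - a) (p - a))⁻¹) ^ 2 := by field_simp
      rw [this]
      exact mul_neg_of_neg_of_pos hpq (by positivity))
    (by
      rw [smul_neg, neg_smul, neg_neg]
      exact eq_smul_add_smul_of_planeDet_ne_zero hD _) hu.1 hu.2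
  have hε : 0 < min ε₁ ε₂ := lt_min h1 h2
  have hpos : ∀ s ∈ Set.Icc 0 (min ε₁ ε₂),
      a + u • (b - a) + s • (p - a) ∈ convexHull ℝ {a, b, p} :=
    fun s hs => h1' s ⟨hs.1, hs.2.trans (min_le_left _ _)⟩
  have hneg : ∀ s ∈ Set.Icc (-min ε₁ ε₂) 0,
      a + u • (b - a) + s • (p - a) ∈ convexHull ℝ {a, b, q} := by
    intro s hs
    have := h2' (-s) ⟨by linarith [hs.2], by linarith [hs.1, min_le_right ε₁ ε₂]⟩
    rwa [smul_neg, neg_smul, neg_neg] at this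
  have hsmooth : ContDiffOn ℝ r (fun s : ℝ => f (a + u • (b - a) + s • (p - a)))
      (Set.Icc (-min ε₁ ε₂) (min ε₁ ε₂)) := by
    refine hf.comp (ContDiff.contDiffOn (by fun_prop)) fun s hs => ?_
    rcases le_total 0 s with h | h
    · exact hp (hpos s ⟨h, hs.2⟩)
    · exact hq (hneg s ⟨hs.1, h⟩)
  have := coeff_eq_of_contDiffOn hε hsmooth
    (p := (coordHom a (b - a) (p - a) P).map (evalRingHom u))
    (q := (coordHom a (b - a) (p - a) Q).map (evalRingHom u))
    (fun s hs => by rw [eval_coordHom, hP _ (hpos s hs)])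
    (fun s hs => by rw [eval_coordHom, hQ _ (hneg s hs)]) (Nat.lt_succ_iff.1 hj)
  simp only [coeff_map, coe_evalRingHom] at this
  simp [this]

/-! ### Triangles at a common edge -/

namespace Triangulation

variable (Δ : Triangulation)

theorem exists_eq_triple {σ : Finset Plane} (hσ : σ ∈ Δ.triangles) {a b : Plane} (hab : a ≠ b)
    (ha : a ∈ σ) (hb : b ∈ σ) :
    ∃ p, p ≠ a ∧ p ≠ b ∧ (σ : Set Plane) = {a, b, p} := by
  classical
  have h2 : ((σ.erase a).erase b).card = 1 := by
    rw [Finset.card_erase_of_mem (by simp [hab.symm, hb]), Finset.card_erase_of_mem ha, hσ.2]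
  obtain ⟨p, hp⟩ := Finset.card_eq_one.1 h2
  have hmem : ∀ x, (x ≠ b ∧ x ≠ a ∧ x ∈ σ) ↔ x = p := by
    intro x
    have := Finset.ext_iff.1 hp x
    simpa using this
  have := (hmem p).2 rfl
  refine ⟨p, this.2.1, this.1, ?_⟩
  ext x
  have hx := hmem x
  simp only [Finset.mem_coe, Set.mem_insert_iff, Set.mem_singleton_iff]
  by_cases hxa : x = a
  · simp [hxa, ha]
  by_cases hxb : x = b
  · simp [hxb, hb]
  simpa [hxa, hxb] using hx

theorem planeDet_ne_zero {σ : Finset Plane} (hσ : σ ∈ Δ.triangles) {a b p : Plane}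
    (hab : a ≠ b) (hpa : p ≠ a) (hpb : p ≠ b) (h : (σ : Set Plane) = {a, b, p}) :
    planeDet (b - a) (p - a) ≠ 0 := by
  intro h0
  have hind : AffineIndependent ℝ (fun x : (σ : Set Plane) => (x : Plane)) := Δ.indep hσ.1
  rw [h] at hind
  let ι : Fin 3 → ({a, b, p} : Set Plane) := ![⟨a, by simp⟩, ⟨b, by simp⟩, ⟨p, by simp⟩]
  have hι : (fun i => (ι i : Plane)) = ![a, b, p] := by
    funext i
    fin_cases i <;> rfl
  have hinj : Function.Injective ![a, b, p] := by
    clear hind h h0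
    intro i j hij
    fin_cases i <;> fin_cases j <;>
      first | rfl | exact absurd hij hab | exact absurd hij hab.symm | exact absurd hij hpa |
        exact absurd hij hpa.symm | exact absurd hij hpb | exact absurd hij hpb.symm
  have hind' : AffineIndependent ℝ ![a, b, p] := by
    rw [← hι] at hinj ⊢
    exact hind.comp_embedding ⟨ι, Function.Injective.of_comp hinj⟩
  rw [affineIndependent_iff_not_collinear_set] at hind'
  apply hind'
  obtain ⟨t, ht⟩ := exists_eq_smul_of_planeDet_eq_zero h0 (sub_ne_zero.2 hab.symm)
  rw [collinear_iff_of_mem (p₀ := a) (by simp)]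
  refine ⟨b - a, ?_⟩
  intro x hx
  rcases hx with rfl | rfl | rfl
  · exact ⟨0, by simp⟩
  · exact ⟨1, by simp⟩
  · exact ⟨t, by rw [← ht]; simp⟩

/-- Two triangles with a common edge lie on different sides of it. -/
theorem planeDet_mul_neg {σ σ' : Finset Plane} (hσ : σ ∈ Δ.triangles) (hσ' : σ' ∈ Δ.triangles)
    {a b p q : Plane} (hab : a ≠ b) (hpa : p ≠ a) (hpb : p ≠ b) (hqa : q ≠ a) (hqb : q ≠ b)
    (hpq : p ≠ q) (h : (σ : Set Plane) = {a, b, p}) (h' : (σ' : Set Plane) = {a, b, q}) :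
    planeDet (b - a) (p - a) * planeDet (b - a) (q - a) < 0 := by
  have hp := Δ.planeDet_ne_zero hσ hab hpa hpb h
  have hq := Δ.planeDet_ne_zero hσ' hab hqa hqb h'
  by_contra! hge
  have hpos := hge.lt_of_ne (mul_ne_zero hp hq).symm
  obtain ⟨ε₁, h1, h1'⟩ := exists_segment_subset_convexHull (a := a) (b := b) (q := p) (w := p - a)
    (α := 0) (γ := 1) (u := 1 / 2) one_pos (by simp) (by norm_num) (by norm_num)
  obtain ⟨ε₂, h2, h2'⟩ := exists_segment_subset_convexHull (a := a) (b := b) (q := q)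
    (w := p - a) (γ := planeDet (b - a) (q - a) / planeDet (b - a) (p - a)) (u := 1 / 2)
    (by
      have : planeDet (b - a) (q - a) / planeDet (b - a) (p - a) =
        (planeDet (b - a) (p - a) * planeDet (b - a) (q - a)) *
          ((planeDet (b - a) (p - a))⁻¹) ^ 2 := by field_simp
      rw [this]
      positivity)
    (eq_smul_add_smul_of_planeDet_ne_zero hp _) (by norm_num) (by norm_num)
  have hε : 0 < min ε₁ ε₂ := lt_min h1 h2
  -- On the same side, the triangles would share a point just off the midpoint of the edge, while
  -- their intersection lies in that edge.
  have hmem := Δ.inter_subset_convexHull hσ.1 hσ'.1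
    ⟨by rw [h]; exact h1' _ ⟨hε.le, min_le_left _ _⟩,
      by rw [h']; exact h2' _ ⟨hε.le, min_le_right _ _⟩⟩
  have hinter : (σ ∩ σ' : Set Plane) = {a, b} := by
    rw [h, h']
    ext x
    simp only [Set.mem_inter_iff, Set.mem_insert_iff, Set.mem_singleton_iff]
    constructor
    · rintro ⟨hx1 | hx1 | hx1, hx2 | hx2 | hx2⟩ <;> simp_all
    · rintro (hx | hx) <;> simp [hx]
  rw [hinter, convexHull_pair, segment_eq_image'] at hmem
  obtain ⟨θ, -, hθ⟩ := hmem
  have h3 := congrArg (fun x => planeDet (b - a) (x - a)) hθ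
  simp only [add_sub_cancel_left, planeDet_smul_right, planeDet_self, mul_zero, add_assoc,
    planeDet_add_right, zero_add] at h3
  exact mul_ne_zero hε.ne' hp h3.symm

theorem lineForm_pow_dvd_sub {r : ℕ} {f : Plane → ℝ}
    (hf : ContDiffOn ℝ r f Δ.toPartition.support) {P : Finset Plane → MvPolynomial (Fin 2) ℝ}
    (hP : ∀ σ ∈ Δ.triangles, ∀ x ∈ convexHull ℝ (σ : Set Plane),
      f x = MvPolynomial.eval (fun i => x i) (P σ))
    {σ σ' : Finset Plane} (hσ : σ ∈ Δ.triangles) (hσ' : σ' ∈ Δ.triangles)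
    {a b : Plane} (hab : a ≠ b) (ha : a ∈ σ) (hb : b ∈ σ) (ha' : a ∈ σ') (hb' : b ∈ σ') :
    lineForm a (b - a) ^ (r + 1) ∣ P σ - P σ' := by
  obtain ⟨p, hpa, hpb, hp⟩ := Δ.exists_eq_triple hσ hab ha hb
  obtain ⟨q, hqa, hqb, hq⟩ := Δ.exists_eq_triple hσ' hab ha' hb'
  by_cases hpq : p = q
  · have : σ = σ' := by rw [← Finset.coe_inj, hp, hq, hpq]
    simp [this]
  · have hsub : ∀ σ ∈ Δ.triangles, convexHull ℝ (σ : Set Plane) ⊆ Δ.toPartition.support :=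
      fun σ hσ => Set.subset_sUnion_of_mem (Set.mem_image_of_mem _ hσ)
    refine _root_.lineForm_pow_dvd_sub hf (p := p) (q := q) ?_ ?_ ?_ ?_
      (Δ.planeDet_mul_neg hσ hσ' hab hpa hpb hqa hqb hpq hp hq)
    · rw [← hp]; exact hsub σ hσ
    · rw [← hq]; exact hsub σ' hσ'
    · rw [← hp]; exact hP σ hσ
    · rw [← hq]; exact hP σ' hσ'

/-- A line has only two sides: three determinants cannot have pairwise opposite signs. -/
theorem eq_or_eq_of_mem_triangles {σ₁ σ₂ σ₃ : Finset Plane} (h₁ : σ₁ ∈ Δ.triangles)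
    (h₂ : σ₂ ∈ Δ.triangles) (h₃ : σ₃ ∈ Δ.triangles) {a b : Plane} (hab : a ≠ b) (ha₁ : a ∈ σ₁)
    (hb₁ : b ∈ σ₁) (ha₂ : a ∈ σ₂) (hb₂ : b ∈ σ₂) (ha₃ : a ∈ σ₃) (hb₃ : b ∈ σ₃) (h : σ₁ ≠ σ₂) :
    σ₃ = σ₁ ∨ σ₃ = σ₂ := by
  obtain ⟨p, hpa, hpb, hp⟩ := Δ.exists_eq_triple h₁ hab ha₁ hb₁
  obtain ⟨q, hqa, hqb, hq⟩ := Δ.exists_eq_triple h₂ hab ha₂ hb₂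
  obtain ⟨o, hoa, hob, ho⟩ := Δ.exists_eq_triple h₃ hab ha₃ hb₃
  by_contra! hne
  have hpq : p ≠ q := by
    rintro rfl
    exact h (by rw [← Finset.coe_inj, hp, hq])
  have hop : p ≠ o := by
    rintro rfl
    exact hne.1 (by rw [← Finset.coe_inj, hp, ho])
  have hoq : q ≠ o := by
    rintro rfl
    exact hne.2 (by rw [← Finset.coe_inj, hq, ho])
  have n1 := Δ.planeDet_mul_neg h₁ h₂ hab hpa hpb hqa hqb hpq hp hq
  have n2 := Δ.planeDet_mul_neg h₁ h₃ hab hpa hpb hoa hob hop hp ho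
  have n3 := Δ.planeDet_mul_neg h₂ h₃ hab hqa hqb hoa hob hoq hq ho
  have := mul_pos_of_neg_of_neg n1 n2
  nlinarith [sq_nonneg (planeDet (b - a) (p - a))]

end Triangulation

/-! ### The star of an interior vertex -/

namespace Triangulation

variable (Δ : Triangulation)

theorem finite_triangles : Δ.triangles.Finite := Δ.finite_faces.subset fun _ h => h.1

theorem finite_edges : Δ.edges.Finite := Δ.finite_faces.subset fun _ h => h.1

theorem pair_mem_edges [DecidableEq Plane] {σ : Finset Plane} (hσ : σ ∈ Δ.triangles) {a b : Plane}
    (hab : a ≠ b) (ha : a ∈ σ) (hb : b ∈ σ) : ({a, b} : Finset Plane) ∈ Δ.edges :=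
  ⟨Δ.down_closed hσ.1 (by simp [Finset.insert_subset_iff, ha, hb]) (Finset.insert_nonempty _ _),
    Finset.card_pair hab⟩

/-- An edge at an interior vertex is contained in exactly two triangles. -/
theorem exists_triangles_of_isInteriorVertex {v : Plane} (hv : Δ.IsInteriorVertex v)
    {e : Finset Plane} (he : e ∈ Δ.edges) (hve : v ∈ e) :
    ∃ σ₁ ∈ Δ.triangles, ∃ σ₂ ∈ Δ.triangles, σ₁ ≠ σ₂ ∧ e ⊆ σ₁ ∧ e ⊆ σ₂ ∧
      ∀ σ ∈ Δ.triangles, e ⊆ σ → σ = σ₁ ∨ σ = σ₂ := by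
  classical
  obtain ⟨σ₁, h₁, hc₁, he₁⟩ := Δ.pure e he.1
  have hnb : ¬ Δ.IsBoundaryEdge e := fun h => hv.2 e h hve
  obtain ⟨σ₂, h₂, he₂, hne⟩ : ∃ σ₂ ∈ Δ.triangles, e ⊆ σ₂ ∧ σ₂ ≠ σ₁ := by
    by_contra! h
    exact hnb ⟨he, σ₁, ⟨⟨h₁, hc₁⟩, he₁⟩, fun σ hσ => h σ hσ.1 hσ.2⟩
  refine ⟨σ₁, ⟨h₁, hc₁⟩, σ₂, h₂, hne.symm, he₁, he₂, fun σ hσ heσ => ?_⟩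
  obtain ⟨a, b, hab, rfl⟩ := Finset.card_eq_two.1 he.2
  have ha : a ∈ ({a, b} : Finset Plane) := by simp
  have hb : b ∈ ({a, b} : Finset Plane) := by simp
  exact Δ.eq_or_eq_of_mem_triangles ⟨h₁, hc₁⟩ h₂ hσ hab (he₁ ha) (he₁ hb) (he₂ ha) (he₂ hb)
    (heσ ha) (heσ hb) hne.symm

/-- A property of triangles at an interior vertex `v` that is preserved when an edge at `v`
different from `{v, v'}` is crossed, and that holds for one of the triangles at the edge
`{v, v'}`, holds for the other one as well. -/
theorem property_of_crossing {v v' : Plane} (hv : Δ.IsInteriorVertex v) (hvv' : v ≠ v')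
    {σ₁ σ₂ : Finset Plane} (h₁ : σ₁ ∈ Δ.triangles) (h₂ : σ₂ ∈ Δ.triangles) (hne : σ₁ ≠ σ₂)
    (hv₁ : v ∈ σ₁) (hv₁' : v' ∈ σ₁) (hv₂ : v ∈ σ₂) (hv₂' : v' ∈ σ₂) {A : Finset Plane → Prop}
    (hA : ∀ x, x ≠ v → x ≠ v' → ∀ σ ∈ Δ.triangles, ∀ σ' ∈ Δ.triangles, v ∈ σ → x ∈ σ →
      v ∈ σ' → x ∈ σ' → A σ → A σ') (hA₁ : A σ₁) : A σ₂ := by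
  classical
  by_contra hA₂
  -- A parity count replaces the cyclic order of the star. Each triangle in `T` has two vertices
  -- besides `v`; each such vertex other than `v'` lies in two triangles of `T`, whereas `v'` would
  -- lie in `σ₁` alone.
  set T := Δ.finite_triangles.toFinset.filter (fun σ => v ∈ σ ∧ A σ) with hT
  have memT : ∀ σ, σ ∈ T ↔ σ ∈ Δ.triangles ∧ v ∈ σ ∧ A σ := by simp [hT]
  set N := T.biUnion fun σ => σ.erase v with hN
  have memN : ∀ x, x ∈ N ↔ x ≠ v ∧ ∃ σ ∈ T, x ∈ σ := by
    intro x
    simp only [hN, Finset.mem_biUnion, Finset.mem_erase]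
    tauto
  have hcount := Finset.sum_card_bipartiteAbove_eq_sum_card_bipartiteBelow (s := T) (t := N)
    (fun (σ : Finset Plane) (x : Plane) => x ∈ σ)
  have hleft : ∀ σ ∈ T, (N.bipartiteAbove (fun (σ : Finset Plane) (x : Plane) => x ∈ σ) σ).card
      = 2 := by
    intro σ hσ
    have : N.bipartiteAbove (fun (σ : Finset Plane) (x : Plane) => x ∈ σ) σ = σ.erase v := by
      ext x
      simp only [Finset.mem_bipartiteAbove, memN, Finset.mem_erase]
      exact ⟨fun h => ⟨h.1.1, h.2⟩, fun h => ⟨⟨h.1, σ, hσ, h.2⟩, h.2⟩⟩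
    rw [this, Finset.card_erase_of_mem ((memT σ).1 hσ).2.1, ((memT σ).1 hσ).1.2]
  have hσ₁ : σ₁ ∈ T := (memT _).2 ⟨h₁, hv₁, hA₁⟩
  have hv'N : v' ∈ N := (memN _).2 ⟨hvv'.symm, σ₁, hσ₁, hv₁'⟩
  have hright : ∀ x ∈ N.erase v',
      Even (T.bipartiteBelow (fun (σ : Finset Plane) (x : Plane) => x ∈ σ) x).card := by
    intro x hx
    obtain ⟨hxv', hxN⟩ := Finset.mem_erase.1 hx
    obtain ⟨hxv, σ, hσT, hxσ⟩ := (memN x).1 hxN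
    obtain ⟨hσ, hvσ, hAσ⟩ := (memT σ).1 hσT
    obtain ⟨ρ₁, hρ₁, ρ₂, hρ₂, hρ, hs₁, hs₂, hall⟩ := Δ.exists_triangles_of_isInteriorVertex hv
      (Δ.pair_mem_edges hσ hxv.symm hvσ hxσ) (Finset.mem_insert_self _ _)
    simp only [Finset.insert_subset_iff, Finset.singleton_subset_iff] at hs₁ hs₂ hall
    have : T.bipartiteBelow (fun (σ : Finset Plane) (x : Plane) => x ∈ σ) x = {ρ₁, ρ₂} := by
      ext ρ
      simp only [Finset.mem_bipartiteBelow, memT, Finset.mem_insert, Finset.mem_singleton]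
      constructor
      · rintro ⟨⟨hρ, hvρ, -⟩, hxρ⟩
        exact hall ρ hρ ⟨hvρ, hxρ⟩
      · have hcross := fun ρ hρ hvρ hxρ => hA x hxv hxv' σ hσ ρ hρ hvσ hxσ hvρ hxρ hAσ
        rintro (rfl | rfl)
        · exact ⟨⟨hρ₁, hs₁.1, hcross _ hρ₁ hs₁.1 hs₁.2⟩, hs₁.2⟩
        · exact ⟨⟨hρ₂, hs₂.1, hcross _ hρ₂ hs₂.1 hs₂.2⟩, hs₂.2⟩
    rw [this, Finset.card_pair hρ]
    exact even_two
  have hv' : T.bipartiteBelow (fun (σ : Finset Plane) (x : Plane) => x ∈ σ) v' = {σ₁} := by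
    ext ρ
    simp only [Finset.mem_bipartiteBelow, memT, Finset.mem_singleton]
    constructor
    · rintro ⟨⟨hρ, hvρ, hAρ⟩, hxρ⟩
      rcases Δ.eq_or_eq_of_mem_triangles h₁ h₂ hρ hvv' hv₁ hv₁' hv₂ hv₂' hvρ hxρ hne with h | h
      · exact h
      · exact absurd (h ▸ hAρ) hA₂
    · rintro rfl
      exact ⟨⟨h₁, hv₁, hA₁⟩, hv₁'⟩
  rw [Finset.sum_congr rfl hleft, ← Finset.add_sum_erase _ _ hv'N, hv', Finset.sum_const,
    smul_eq_mul, Finset.card_singleton] at hcount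
  obtain ⟨m, hm⟩ := Finset.even_sum _ hright
  omega

/-- Modulo `I` the polynomial does not change across any edge at `v` other than `{v, v'}`, so
membership propagates around `v`. -/
theorem sub_mem_span {r : ℕ} {f : Plane → ℝ}
    (hf : ContDiffOn ℝ r f Δ.toPartition.support) {P : Finset Plane → MvPolynomial (Fin 2) ℝ}
    (hP : ∀ σ ∈ Δ.triangles, ∀ x ∈ convexHull ℝ (σ : Set Plane),
      f x = MvPolynomial.eval (fun i => x i) (P σ))
    {v v' : Plane} (hv : Δ.IsInteriorVertex v) (hvv' : v ≠ v')
    {σ₁ σ₂ : Finset Plane} (h₁ : σ₁ ∈ Δ.triangles) (h₂ : σ₂ ∈ Δ.triangles) (hne : σ₁ ≠ σ₂)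
    (hv₁ : v ∈ σ₁) (hv₁' : v' ∈ σ₁) (hv₂ : v ∈ σ₂) (hv₂' : v' ∈ σ₂)
    {I : Ideal (MvPolynomial (Fin 2) ℝ)}
    (hI : ∀ x, x ≠ v → x ≠ v' → (∃ σ ∈ Δ.triangles, v ∈ σ ∧ x ∈ σ) →
      lineForm v (x - v) ^ (r + 1) ∈ I) : P σ₁ - P σ₂ ∈ I := by
  refine Δ.property_of_crossing hv hvv' h₁ h₂ hne hv₁ hv₁' hv₂ hv₂' (A := fun σ => P σ₁ - P σ ∈ I)
    ?_ (by simp)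
  intro x hxv hxv' σ hσ σ' hσ' hvσ hxσ hvσ' hxσ' h
  have h3 := I.mem_of_dvd (Δ.lineForm_pow_dvd_sub hf hP hσ hσ' hxv.symm hvσ hxσ hvσ' hxσ')
    (hI x hxv hxv' ⟨σ, hσ, hvσ, hxσ⟩)
  have := I.add_mem h h3
  rwa [sub_add_sub_cancel] at this

theorem lineForm_smul (v w : Plane) (c : ℝ) :
    lineForm v (c • w) = MvPolynomial.C c * lineForm v w := by
  simp [lineForm]
  ring

theorem planeDet_ne_zero_of_vectorSpan_ne {v x a b : Plane} (hvx : v ≠ x) (hab : a ≠ b)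
    (h : vectorSpan ℝ {v, x} ≠ vectorSpan ℝ {a, b}) : planeDet (b - a) (x - v) ≠ 0 := by
  intro h0
  apply h
  obtain ⟨t, ht⟩ := exists_eq_smul_of_planeDet_eq_zero h0 (sub_ne_zero.2 hab.symm)
  have ht0 : t ≠ 0 := by
    rintro rfl
    exact sub_ne_zero.2 hvx.symm (by simpa using ht)
  rw [vectorSpan_pair_rev, vectorSpan_pair_rev, vsub_eq_sub, vsub_eq_sub, ht]
  exact Submodule.span_singleton_smul_eq (IsUnit.mk0 t ht0) _

/-- One edge direction at `v` for each slope of the edges at `v` other than `τ`. -/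
theorem exists_slope_representatives {v v' : Plane} {τ : Finset Plane}
    (hτ : (τ : Set Plane) = {v, v'}) (hvv' : v ≠ v')
    (hslope : ∀ e ∈ Δ.otherEdgesAt τ v, vectorSpan ℝ (e : Set Plane) ≠ vectorSpan ℝ (τ : Set Plane))
    (r : ℕ) :
    ∃ (S : Finset (Submodule ℝ Plane)) (w : Submodule ℝ Plane → Plane),
      S.card = Δ.numSlopes τ v ∧ (∀ D ∈ S, planeDet (v' - v) (w D) ≠ 0) ∧
      ∀ x, x ≠ v → x ≠ v' → (∃ σ ∈ Δ.triangles, v ∈ σ ∧ x ∈ σ) →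
        lineForm v (x - v) ^ (r + 1) ∈
          Ideal.span ((fun D => lineForm v (w D) ^ (r + 1)) '' (S : Set (Submodule ℝ Plane))) := by
  classical
  have hfin : ((fun e : Finset Plane => vectorSpan ℝ (e : Set Plane)) ''
      Δ.otherEdgesAt τ v).Finite := (Δ.finite_edges.subset fun _ h => h.1).image _
  have hrep : ∀ D : Submodule ℝ Plane, ∃ w : Plane,
      D ∈ hfin.toFinset → planeDet (v' - v) w ≠ 0 ∧ D = Submodule.span ℝ {w} := by
    intro D
    by_cases hD : D ∈ hfin.toFinset
    · obtain ⟨e, he, rfl⟩ := hfin.mem_toFinset.1 hD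
      obtain ⟨a, b, hab, rfl⟩ := Finset.card_eq_two.1 he.1.2
      obtain ⟨x, hx, hex⟩ : ∃ x, v ≠ x ∧ ({a, b} : Finset Plane) = {v, x} := by
        rcases Finset.mem_insert.1 he.2.1 with h | h
        · exact ⟨b, h ▸ hab, by rw [h]⟩
        · rw [Finset.mem_singleton] at h
          exact ⟨a, h ▸ hab.symm, by rw [h, Finset.pair_comm]⟩
      have hsl := hslope _ he
      rw [hex, hτ, Finset.coe_pair] at hsl
      refine ⟨x - v, fun _ => ⟨planeDet_ne_zero_of_vectorSpan_ne hx hvv' hsl, ?_⟩⟩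
      simp only [hex, Finset.coe_pair, vectorSpan_pair_rev, vsub_eq_sub]
    · exact ⟨0, fun h => absurd h hD⟩
  choose w hw using hrep
  refine ⟨hfin.toFinset, w, ?_, fun D hD => (hw D hD).1, ?_⟩
  · rw [numSlopes, Set.ncard_eq_toFinset_card _ hfin]
  · rintro x hxv hxv' ⟨σ, hσ, hvσ, hxσ⟩
    have hD : vectorSpan ℝ {v, x} ∈ hfin.toFinset := by
      rw [hfin.mem_toFinset]
      refine ⟨{v, x}, ⟨Δ.pair_mem_edges hσ hxv.symm hvσ hxσ, by simp, ?_⟩, by simp⟩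
      intro h
      have : x ∈ (τ : Set Plane) := by rw [← h]; simp
      rw [hτ] at this
      simp [hxv, hxv'] at this
    -- Edges at `v` of equal slope have proportional line forms, so one generator per slope
    -- suffices.
    have hx : x - v ∈ Submodule.span ℝ {w (vectorSpan ℝ {v, x})} := by
      rw [← (hw _ hD).2]
      exact vsub_rev_mem_vectorSpan_pair ℝ v x
    obtain ⟨c, hc⟩ := Submodule.mem_span_singleton.1 hx
    rw [← hc, lineForm_smul, mul_pow]
    exact Ideal.mul_mem_left _ _ (Ideal.subset_span ⟨_, hD, rfl⟩)

theorem eq_of_mem_triangles {v₁ v₂ : Plane} {τ : Finset Plane} {r d : ℕ}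
    (hτ : (τ : Set Plane) = {v₁, v₂}) (hv : v₁ ≠ v₂) (hv₁ : Δ.IsInteriorVertex v₁)
    (hv₂ : Δ.IsInteriorVertex v₂)
    (hslope : ∀ v ∈ τ, ∀ e ∈ Δ.otherEdgesAt τ v,
      vectorSpan ℝ (e : Set Plane) ≠ vectorSpan ℝ (τ : Set Plane))
    (hs2 : 2 ≤ Δ.numSlopes τ v₁) (hst : Δ.numSlopes τ v₁ ≤ Δ.numSlopes τ v₂)
    (hd : (d : ℝ) ≤ (Δ.numSlopes τ v₂ : ℝ) / ((Δ.numSlopes τ v₁ : ℝ) *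
      ((Δ.numSlopes τ v₂ : ℝ) - 1)) * (r : ℝ) + (r : ℝ)) {f : Plane → ℝ}
    (hf : ContDiffOn ℝ r f Δ.toPartition.support) {P : Finset Plane → MvPolynomial (Fin 2) ℝ}
    (hP : ∀ σ ∈ Δ.triangles, ∀ x ∈ convexHull ℝ (σ : Set Plane),
      f x = MvPolynomial.eval (fun i => x i) (P σ))
    (hPd : ∀ σ ∈ Δ.triangles, (P σ).totalDegree ≤ d) {σ₁ σ₂ : Finset Plane}
    (h₁ : σ₁ ∈ Δ.triangles) (h₂ : σ₂ ∈ Δ.triangles) (ht₁ : τ ⊆ σ₁) (ht₂ : τ ⊆ σ₂) :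
    P σ₁ = P σ₂ := by
  by_cases hne : σ₁ = σ₂
  · rw [hne]
  have hm₁ : v₁ ∈ τ := by rw [← Finset.mem_coe, hτ]; simp
  have hm₂ : v₂ ∈ τ := by rw [← Finset.mem_coe, hτ]; simp
  obtain ⟨S, w, hS, hw, hI⟩ := Δ.exists_slope_representatives hτ hv (hslope v₁ hm₁) r
  obtain ⟨S', w', hS', hw', hI'⟩ := Δ.exists_slope_representatives
    (hτ.trans (Set.pair_comm _ _)) hv.symm (hslope v₂ hm₂) r
  obtain ⟨p, hp1, hp2, hp⟩ := Δ.exists_eq_triple h₁ hv (ht₁ hm₁) (ht₁ hm₂)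
  rw [← sub_eq_zero]
  rw [← hS] at hs2 hst hd
  rw [← hS'] at hst hd
  refine eq_zero_of_mem_span (v := v₁) (a := v₂ - v₁) (w' := w')
    (Δ.planeDet_ne_zero h₁ hv hp1 hp2 hp) hw ?_
    ((MvPolynomial.totalDegree_sub _ _).trans (max_le (hPd _ h₁) (hPd _ h₂)))
    (Δ.sub_mem_span hf hP hv₁ hv h₁ h₂ hne (ht₁ hm₁) (ht₁ hm₂) (ht₂ hm₁) (ht₂ hm₂) hI) ?_
    (Δ.lineForm_pow_dvd_sub hf hP h₁ h₂ hv (ht₁ hm₁) (ht₁ hm₂) (ht₂ hm₁) (ht₂ hm₂)) hs2 hst hd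
  · intro D hD h0
    apply hw' D hD
    simp only [planeDet, PiLp.sub_apply] at h0 ⊢
    linarith
  · rw [add_sub_cancel]
    exact Δ.sub_mem_span hf hP hv₂ hv.symm h₁ h₂ hne (ht₁ hm₂) (ht₁ hm₁) (ht₂ hm₂) (ht₂ hm₁) hI'

/-! ### The partition without the edge -/

/-- The midpoint of an edge lies in a triangle only if the edge is a side of it. -/
theorem subset_of_midpoint_mem {e σ : Finset Plane} (he : e ∈ Δ.edges) (hσ : σ ∈ Δ.triangles)
    {a b : Plane} (hab : a ≠ b) (heq : (e : Set Plane) = {a, b})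
    (h : midpoint ℝ a b ∈ convexHull ℝ (σ : Set Plane)) : e ⊆ σ := by
  have hme : midpoint ℝ a b ∈ convexHull ℝ (e : Set Plane) := by
    rw [heq, convexHull_pair]
    exact midpoint_mem_segment a b
  have hm := Δ.inter_subset_convexHull he.1 hσ.1 ⟨hme, h⟩
  rw [heq] at hm
  have ha : a ∈ σ := by
    by_contra ha
    have hsub : ({a, b} ∩ σ : Set Plane) ⊆ {b} := by
      rintro x ⟨hx | hx, hxσ⟩
      · exact absurd (hx ▸ hxσ) ha
      · exact hx
    have := convexHull_mono hsub hm
    rw [convexHull_singleton, Set.mem_singleton_iff, midpoint_eq_right_iff] at this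
    exact hab this
  have hb : b ∈ σ := by
    by_contra hb
    have hsub : ({a, b} ∩ σ : Set Plane) ⊆ {a} := by
      rintro x ⟨hx | hx, hxσ⟩
      · exact hx
      · exact absurd (hx ▸ hxσ) hb
    have := convexHull_mono hsub hm
    rw [convexHull_singleton, Set.mem_singleton_iff, midpoint_eq_left_iff] at this
    exact hab this
  intro x hx
  have : x ∈ (e : Set Plane) := hx
  rw [heq] at this
  rcases this with rfl | rfl <;> assumption

/-- A boundary edge stays a boundary edge when an edge at an interior vertex is deleted. -/
theorem IsBoundaryEdge.deleteEdge {b τ : Finset Plane} (hb : Δ.IsBoundaryEdge b) (hbτ : b ≠ τ) :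
    (Δ.deleteEdge τ).IsBoundaryEdge b := by
  classical
  obtain ⟨hbe, σ₀, ⟨hσ₀, hbσ₀⟩, huniq⟩ := hb
  obtain ⟨p, q, hpq, hb⟩ := Finset.card_eq_two.1 hbe.2
  have heq : (b : Set Plane) = {p, q} := by rw [hb, Finset.coe_pair]
  have hmid : midpoint ℝ p q ∈ convexHull ℝ (b : Set Plane) := by
    rw [heq, convexHull_pair]
    exact midpoint_mem_segment p q
  -- The midpoint is a test point that also works for the merged cell: it lies in one of the
  -- triangles of the union, and that triangle must be `σ₀`.
  have huniq' : ∀ σ ∈ Δ.triangles, midpoint ℝ p q ∈ convexHull ℝ (σ : Set Plane) → σ = σ₀ :=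
    fun σ hσ h => huniq σ ⟨hσ, Δ.subset_of_midpoint_mem hbe hσ hpq heq h⟩
  have hsub : convexHull ℝ (b : Set Plane) ⊆ convexHull ℝ (σ₀ : Set Plane) :=
    convexHull_mono (by exact_mod_cast hbσ₀)
  refine ⟨⟨hbe, hbτ⟩, ?_⟩
  by_cases hτ : τ ⊆ σ₀
  · refine ⟨_, ⟨Set.mem_insert _ _, hsub.trans (Set.subset_biUnion_of_mem
      (u := fun σ : Finset Plane => convexHull ℝ (σ : Set Plane)) ⟨hσ₀, hτ⟩)⟩, ?_⟩
    rintro c ⟨rfl | ⟨σ, ⟨hσ, hτσ⟩, rfl⟩, hc⟩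
    · rfl
    · exact absurd ((huniq' σ hσ (hc hmid)).symm ▸ hτ) hτσ
  · refine ⟨convexHull ℝ (σ₀ : Set Plane), ⟨Set.mem_insert_of_mem _ ⟨σ₀, ⟨hσ₀, hτ⟩, rfl⟩, hsub⟩, ?_⟩
    rintro c ⟨rfl | ⟨σ, ⟨hσ, hτσ⟩, rfl⟩, hc⟩
    · obtain ⟨σ, ⟨hσ, hτσ⟩, hm⟩ := Set.mem_iUnion₂.1 (hc hmid)
      exact absurd (huniq' σ hσ hm ▸ hτσ) hτ
    · rw [huniq' σ hσ (hc hmid)]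

/-- Every remaining edge already has an endpoint on the boundary, so the chain of length zero
suffices. -/
theorem deleteEdge_isQuasiCrossCut {τ : Finset Plane} (hsingle : Δ.totallyInteriorEdges = {τ}) :
    (Δ.deleteEdge τ).IsQuasiCrossCut := by
  rintro e ⟨he, heτ⟩
  have hτ : τ ∈ Δ.totallyInteriorEdges := by rw [hsingle]; rfl
  have hne : e ∉ Δ.totallyInteriorEdges := by rwa [hsingle]
  obtain ⟨v, hve, hv⟩ : ∃ v ∈ e, ¬ Δ.IsInteriorVertex v := by
    by_contra! h
    exact hne ⟨he, h⟩
  have hvert : v ∈ Δ.vertices :=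
    Δ.down_closed he.1 (Finset.singleton_subset_iff.2 hve) (Finset.singleton_nonempty _)
  obtain ⟨b, hb, hvb⟩ : ∃ b, Δ.IsBoundaryEdge b ∧ v ∈ b := by
    by_contra! h
    exact hv ⟨hvert, h⟩
  refine ⟨e, Relation.ReflTransGen.refl, v, hve, b, IsBoundaryEdge.deleteEdge Δ hb ?_, hvb⟩
  rintro rfl
  exact hv (hτ.2 v hvb)

theorem support_deleteEdge (τ : Finset Plane) :
    (Δ.deleteEdge τ).support = Δ.toPartition.support := by
  ext x
  simp only [PlanarPartition.support, deleteEdge, toPartition, Set.mem_sUnion]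
  constructor
  · rintro ⟨c, rfl | ⟨σ, ⟨hσ, -⟩, rfl⟩, hx⟩
    · obtain ⟨σ, ⟨hσ, -⟩, hx⟩ := Set.mem_iUnion₂.1 hx
      exact ⟨_, ⟨σ, hσ, rfl⟩, hx⟩
    · exact ⟨_, ⟨σ, hσ, rfl⟩, hx⟩
  · rintro ⟨c, ⟨σ, hσ, rfl⟩, hx⟩
    by_cases h : τ ⊆ σ
    · exact ⟨_, Or.inl rfl, Set.mem_iUnion₂.2 ⟨σ, ⟨hσ, h⟩, hx⟩⟩
    · exact ⟨_, Or.inr ⟨σ, ⟨hσ, h⟩, rfl⟩, hx⟩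

theorem finite_cells_toPartition : Δ.toPartition.cells.Finite := Δ.finite_triangles.image _

theorem finite_cells_deleteEdge (τ : Finset Plane) : (Δ.deleteEdge τ).cells.Finite :=
  ((Δ.finite_triangles.subset fun _ h => h.1).image _).insert _

end Triangulation

/-! ### Dimensions of spline spaces -/

namespace PlanarPartition

/-- A spline is determined by its restrictions to the finitely many cells, each in the image of the
polynomials of degree at most `d`. -/
theorem finiteDimensional_splineSpace (P : PlanarPartition) (hP : P.cells.Finite) (r d : ℕ) :
    FiniteDimensional ℝ (P.splineSpace r d) := by
  have := hP.to_subtype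
  let res (c : P.cells) : (P.support → ℝ) →ₗ[ℝ] (c.1 → ℝ) :=
    LinearMap.pi fun x => LinearMap.proj ⟨x, Set.mem_sUnion_of_mem x.2 c.2⟩
  let ev (c : P.cells) : MvPolynomial (Fin 2) ℝ →ₗ[ℝ] (c.1 → ℝ) :=
    LinearMap.pi fun x => (MvPolynomial.aeval fun i => (x : Plane) i).toLinearMap
  let V (c : P.cells) : Submodule ℝ (c.1 → ℝ) :=
    (MvPolynomial.restrictTotalDegree (Fin 2) ℝ d).map (ev c)
  have hV : ∀ (F : P.splineSpace r d) (c : P.cells), res c F.1 ∈ V c := by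
    intro F c
    obtain ⟨p, hp, hF⟩ := F.2.2 c c.2
    refine ⟨p, (MvPolynomial.mem_restrictTotalDegree _ _ _).2 hp, ?_⟩
    ext x
    have := hF ⟨x, Set.mem_sUnion_of_mem x.2 c.2⟩ x.2
    simpa [res, ev, MvPolynomial.aeval_eq_eval] using this.symm
  let Φ : P.splineSpace r d →ₗ[ℝ] ((c : P.cells) → V c) :=
    LinearMap.pi fun c => ((res c).comp (P.splineSpace r d).subtype).codRestrict (V c)
      fun F => hV F c
  refine Module.Finite.of_injective Φ fun F F' h => ?_
  ext x
  obtain ⟨c, hc, hx⟩ := x.2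
  have := congrFun (congrArg Subtype.val (congrFun h ⟨c, hc⟩)) ⟨x, hx⟩
  exact this

/-- The splines live on different subtypes, but the smoothness condition extends each to a function
on the plane, where they can be compared. -/
theorem finrank_splineSpace_eq {P Q : PlanarPartition} {r d : ℕ} (hsupp : P.support = Q.support)
    (h : ∀ f : Plane → ℝ, (fun x : P.support => f x) ∈ P.splineSpace r d ↔
      (fun x : Q.support => f x) ∈ Q.splineSpace r d) :
    Module.finrank ℝ (P.splineSpace r d) = Module.finrank ℝ (Q.splineSpace r d) := by
  let E : (P.support → ℝ) ≃ₗ[ℝ] (Q.support → ℝ) :=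
    LinearEquiv.funCongrLeft ℝ ℝ (Equiv.setCongr hsupp.symm)
  have hmap : (P.splineSpace r d).map (E : (P.support → ℝ) →ₗ[ℝ] (Q.support → ℝ)) =
      Q.splineSpace r d := by
    ext F
    constructor
    · rintro ⟨F, hF, rfl⟩
      obtain ⟨f, -, hf⟩ := hF.1
      have hF' : F = fun x : P.support => f x := funext hf
      rw [hF'] at hF ⊢
      exact (h f).1 hF
    · intro hF
      obtain ⟨f, -, hf⟩ := hF.1
      have hF' : F = fun x : Q.support => f x := funext hf
      rw [hF'] at hF ⊢
      exact ⟨_, (h f).2 hF, rfl⟩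
  rw [← hmap]
  exact (LinearEquiv.finrank_map_eq E _).symm

end PlanarPartition

/-! ### The main theorem -/

theorem mainTheorem5 (Δ : Triangulation) (v₁ v₂ : Plane) (τ : Finset Plane) (r d s t : ℕ)
    (hτ : (τ : Set Plane) = {v₁, v₂})
    (hsingle : Δ.totallyInteriorEdges = {τ})
    (hslope : ∀ v ∈ τ, ∀ e ∈ Δ.otherEdgesAt τ v,
      vectorSpan ℝ (e : Set Plane) ≠ vectorSpan ℝ (τ : Set Plane))
    (hs : Δ.numSlopes τ v₁ = s) (ht : Δ.numSlopes τ v₂ = t)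
    (hs2 : 2 ≤ s) (hst : s ≤ t) (htr : t ≤ r + 1)
    (hd : (d : ℝ) ≤ (t : ℝ) / ((s : ℝ) * ((t : ℝ) - 1)) * (r : ℝ) + (r : ℝ)) :
    (Δ.deleteEdge τ).IsQuasiCrossCut ∧
      FiniteDimensional ℝ (Δ.toPartition.splineSpace r d) ∧
      FiniteDimensional ℝ ((Δ.deleteEdge τ).splineSpace r d) ∧
      Module.finrank ℝ (Δ.toPartition.splineSpace r d) =
        Module.finrank ℝ ((Δ.deleteEdge τ).splineSpace r d) := by
  classical
  refine ⟨Δ.deleteEdge_isQuasiCrossCut hsingle,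
    PlanarPartition.finiteDimensional_splineSpace _ Δ.finite_cells_toPartition r d,
    PlanarPartition.finiteDimensional_splineSpace _ (Δ.finite_cells_deleteEdge τ) r d,
    PlanarPartition.finrank_splineSpace_eq (Δ.support_deleteEdge τ).symm fun f => ?_⟩
  have hτi : τ ∈ Δ.totallyInteriorEdges := by rw [hsingle]; rfl
  have hv : v₁ ≠ v₂ := by
    rintro rfl
    have hcard := hτi.1.2
    rw [← Set.ncard_coe_finset, hτ] at hcard
    simp at hcard
  have hm₁ : v₁ ∈ τ := by rw [← Finset.mem_coe, hτ]; simp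
  have hm₂ : v₂ ∈ τ := by rw [← Finset.mem_coe, hτ]; simp
  subst hs ht
  have hsub : ∀ σ ∈ Δ.triangles, convexHull ℝ (σ : Set Plane) ⊆ Δ.toPartition.support :=
    fun σ hσ => Set.subset_sUnion_of_mem (Set.mem_image_of_mem _ hσ)
  constructor
  · rintro ⟨⟨g, hg, hfg⟩, hcells⟩
    refine ⟨⟨g, by rwa [Δ.support_deleteEdge], fun x =>
      hfg ⟨x, (Δ.support_deleteEdge τ) ▸ x.2⟩⟩, ?_⟩
    have hpoly : ∀ σ : Finset Plane, ∃ p : MvPolynomial (Fin 2) ℝ, σ ∈ Δ.triangles →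
        p.totalDegree ≤ d ∧ ∀ x ∈ convexHull ℝ (σ : Set Plane),
          f x = MvPolynomial.eval (fun i => x i) p := by
      intro σ
      by_cases hσ : σ ∈ Δ.triangles
      · obtain ⟨p, hpd, hp⟩ := hcells _ (Set.mem_image_of_mem _ hσ)
        exact ⟨p, fun _ => ⟨hpd, fun x hx => hp ⟨x, hsub σ hσ hx⟩ hx⟩⟩
      · exact ⟨0, fun h => absurd h hσ⟩
    choose P hP using hpoly
    -- All triangles at `τ` carry the same polynomial, which therefore serves on the merged cell.
    have heq := fun σ₁ σ₂ h₁ h₂ => Δ.eq_of_mem_triangles (σ₁ := σ₁) (σ₂ := σ₂) hτ hv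
      (hτi.2 _ hm₁) (hτi.2 _ hm₂) hslope hs2 hst hd hg
      (fun σ hσ x hx => (hfg ⟨x, hsub σ hσ hx⟩).symm.trans ((hP σ hσ).2 x hx))
      (fun σ hσ => (hP σ hσ).1) h₁ h₂
    rintro c (rfl | ⟨σ, ⟨hσ, -⟩, rfl⟩)
    · obtain ⟨σ₀, hσ₀, hc₀, hτσ₀⟩ := Δ.pure τ hτi.1.1
      refine ⟨P σ₀, (hP σ₀ ⟨hσ₀, hc₀⟩).1, fun x hx => ?_⟩
      obtain ⟨σ, ⟨hσ, hτσ⟩, hx⟩ := Set.mem_iUnion₂.1 hx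
      rw [heq σ₀ σ ⟨hσ₀, hc₀⟩ hσ hτσ₀ hτσ]
      exact (hP σ hσ).2 x hx
    · exact ⟨P σ, (hP σ hσ).1, fun x hx => (hP σ hσ).2 x hx⟩
  · rintro ⟨⟨g, hg, hfg⟩, hcells⟩
    refine ⟨⟨g, by rwa [← Δ.support_deleteEdge τ], fun x =>
      hfg ⟨x, (Δ.support_deleteEdge τ).symm ▸ x.2⟩⟩, ?_⟩
    rintro c ⟨σ, hσ, rfl⟩
    by_cases h : τ ⊆ σ
    · obtain ⟨p, hpd, hp⟩ := hcells _ (Set.mem_insert _ _)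
      exact ⟨p, hpd, fun x hx => hp ⟨x, (Δ.support_deleteEdge τ).symm ▸ x.2⟩
        (Set.mem_iUnion₂.2 ⟨σ, ⟨hσ, h⟩, hx⟩)⟩
    · obtain ⟨p, hpd, hp⟩ := hcells _ (Set.mem_insert_of_mem _ ⟨σ, ⟨hσ, h⟩, rfl⟩)
      exact ⟨p, hpd, fun x hx => hp ⟨x, (Δ.support_deleteEdge τ).symm ▸ x.2⟩ hx⟩
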